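/- Let $n\ge 0$. Write a set partition of $[n]=\{1,\dots,n\}$ as $(B_1,\dots,B_k)$ with $\min B_1<\cdots<\min B_k$. Its diagram has an edge $(i,j)$, $i<j$, exactly when $i$ and $j$ lie in the same block and no element of that block lies strictly between them. Its canonical word is $a_1\cdots a_n$ with $a_i=j$ if $i\in B_j$. A partition is 2-distant noncrossing if there are no two edges $(i_1,j_1),(i_2,j_2)$ with $i_1<i_2\le j_1<j_2$ and $j_1-i_2\ge 2$; let $\mathrm{NC}_n$ be the set of these. A partition is 12312-avoiding if its canonical word has no (not necessarily contiguous) subword that is order-isomorphic to $12312$; let $\mathrm{A}_n$ be the set of these, each identified with its canonical word. Let $\pi\in \mathrm{NC}_n$. For $0\le i\le n$ let $T_i$ be the partition of $[i]$ obtained from $\pi$ by removing all integers greater than $i$, in which an integer $j\le i$ is called active if $\pi$ has an edge $(j,k)$ with $k>i$. Define words $w_0,\dots,w_n$, some of whose letters (as positions in the word) are marked active, as follows. The word $w_0$ is empty. For $1\le i\le n$: (1) If $i$ is not joined by an edge to any integer in $T_i$, then $w_i=w_{i-1}m$ with $m=\max(w_{i-1})+1$ (where $\max$ of the empty word is $0$),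 the new letter being inactive and all other marks unchanged. Otherwise $i$ is joined by an edge to the largest or to the second largest active integer of $T_{i-1}$. If it is the largest, let $w_i=w_{i-1}a_1$, where $a_1$ is the rightmost active letter of $w_{i-1}$; if it is the second largest, let $w_i=w_{i-1}a_2$, where $a_2$ is the second rightmost active letter of $w_{i-1}$. In both cases the new letter is inactive, the rightmost active letter of $w_{i-1}$ is made inactive, and all other marks are unchanged. (2) Then, if $i$ is active in $T_i$, the leftmost occurrence of the largest letter of $w_i$ is made active. Then this procedure can always be carried out, the map $\pi\mapsto w_n$ (forgetting the marks) is a bijection from $\mathrm{NC}_n$ onto $\mathrm{A}_n$, and it preserves the number of blocks. -/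

import Mathlib

namespace DirectBijection

/-- `(i, j)` is an edge of the partition diagram of `π`: `i < j` lie in the same block and
no integer of that block lies strictly between them. -/
def IsEdge {s : Finset ℕ} (π : Finpartition s) (i j : ℕ) : Prop :=
  i < j ∧ ∃ B ∈ π.parts, i ∈ B ∧ j ∈ B ∧ ∀ k ∈ B, ¬ (i < k ∧ k < j)

instance decidableIsEdge {s : Finset ℕ} (π : Finpartition s) (i j : ℕ) :
    Decidable (IsEdge π i j) :=
  inferInstanceAs (Decidable (i < j ∧ ∃ B ∈ π.parts, i ∈ B ∧ j ∈ B ∧ ∀ k ∈ B, ¬ (i < k ∧ k < j)))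

/-- The integer `j` is connected by an edge of the diagram of `π` to an integer greater than `i`. -/
def ConnectedBeyond {s : Finset ℕ} (π : Finpartition s) (i j : ℕ) : Prop :=
  ∃ k ∈ s, i < k ∧ IsEdge π j k

instance decidableConnectedBeyond {s : Finset ℕ} (π : Finpartition s) (i j : ℕ) :
    Decidable (ConnectedBeyond π i j) :=
  inferInstanceAs (Decidable (∃ k ∈ s, i < k ∧ IsEdge π j k))

/-- `π` has no `k`-distant crossing, that is, no two edges `(i₁, j₁)` and `(i₂, j₂)` with
`i₁ < i₂ ≤ j₁ < j₂` and `j₁ - i₂ ≥ k`. -/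
def IsDistantNoncrossing {s : Finset ℕ} (k : ℕ) (π : Finpartition s) : Prop :=
  ¬ ∃ i₁ j₁ i₂ j₂ : ℕ, IsEdge π i₁ j₁ ∧ IsEdge π i₂ j₂ ∧
    i₁ < i₂ ∧ i₂ ≤ j₁ ∧ j₁ < j₂ ∧ i₂ + k ≤ j₁

/-- The index of the block containing `i` when the blocks are numbered `1, 2, …` in the order
of increasing minima: the number of blocks whose minimum is at most that of the block of `i`. -/
def blockIndex {s : Finset ℕ} (π : Finpartition s) (i : ℕ) : ℕ :=
  (π.parts.filter fun B => B.min ≤ (π.part i).min).card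

/-- The canonical word `a₁ a₂ ⋯ aₙ` of a partition of `[n]`: `aᵢ` is the index of the block
containing `i`. -/
def canonicalWord {n : ℕ} (π : Finpartition (Finset.Icc 1 n)) : List ℕ :=
  (List.range' 1 n).map (blockIndex π)

/-- Two words are order-isomorphic: they have the same length and their letters compare in the
same way (equal letters included). -/
def OrderIsomorphic (u v : List ℕ) : Prop :=
  u.length = v.length ∧
    ∀ i < u.length, ∀ j < u.length, (u.getD i 0 < u.getD j 0 ↔ v.getD i 0 < v.getD j 0)

/-- `π` is `τ`-avoiding: no (not necessarily contiguous) subword of its canonical word is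
order-isomorphic to `τ`. -/
def Avoids {n : ℕ} (τ : List ℕ) (π : Finpartition (Finset.Icc 1 n)) : Prop :=
  ¬ ∃ u : List ℕ, u.Sublist (canonicalWord π) ∧ OrderIsomorphic u τ

/-- A partition together with a set of marked (active) integers. -/
structure MarkedPartition (s : Finset ℕ) where
  partition : Finpartition s
  active : Finset ℕ
  active_subset : active ⊆ s

/-- The marked partition `Tᵢ` of `[i]` (for `i ≤ n`) obtained from a partition `π` of `[n]` by
removing all integers greater than `i` and marking those integers that are connected by an edge
of the diagram of `π` to an integer greater than `i`. -/
def markedRestriction {n : ℕ} (π : Finpartition (Finset.Icc 1 n)) (i : ℕ) :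
    MarkedPartition ((Finset.Icc 1 n).filter (· ≤ i)) where
  partition := π.restrict (Finset.filter_subset _ _)
  active := ((Finset.Icc 1 n).filter (· ≤ i)).filter (ConnectedBeyond π i)
  active_subset := Finset.filter_subset _ _

/-- A word together with a set of marked (active) positions; the first letter has position `0`. -/
structure MarkedWord where
  letters : List ℕ
  active : Finset ℕ

/-- The largest element of `s`, if there is one. -/
def largest (s : Finset ℕ) : Option ℕ := (s.sort (· ≥ ·))[0]?

/-- The second largest element of `s`, if there is one. -/
def secondLargest (s : Finset ℕ) : Option ℕ := (s.sort (· ≥ ·))[1]?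

/-- The largest letter of a word, and `0` for the empty word. -/
def maxLetter (w : List ℕ) : ℕ := w.foldr max 0

/-- The first part of the passage from `w = wᵢ₋₁` to `wᵢ`, where `S = Tᵢ₋₁` and `T = Tᵢ`: a letter
is appended and possibly an active letter is made inactive. The value `none` means that the
instructions cannot be carried out. -/
def appendLetter {s t : Finset ℕ} (i : ℕ) (S : MarkedPartition s) (T : MarkedPartition t)
    (w : MarkedWord) : Option MarkedWord :=
  if ∀ j ∈ t, ¬ IsEdge T.partition j i then
    some ⟨w.letters ++ [maxLetter w.letters + 1], w.active⟩
  else if ∃ j ∈ S.active, largest S.active = some j ∧ IsEdge T.partition j i then do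
    let p ← largest w.active
    let a₁ ← w.letters[p]?
    return ⟨w.letters ++ [a₁], w.active.erase p⟩
  else if ∃ j ∈ S.active, secondLargest S.active = some j ∧ IsEdge T.partition j i then do
    let p ← largest w.active
    let q ← secondLargest w.active
    let a₂ ← w.letters[q]?
    return ⟨w.letters ++ [a₂], w.active.erase p⟩
  else none

/-- The second part of the passage from `wᵢ₋₁` to `wᵢ`: if `i` is active in `T = Tᵢ`, then the
leftmost occurrence of the largest letter is made active. -/
def activateMax {t : Finset ℕ} (i : ℕ) (T : MarkedPartition t) (w : MarkedWord) : MarkedWord :=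
  if i ∈ T.active then
    ⟨w.letters, insert (w.letters.idxOf (maxLetter w.letters)) w.active⟩
  else w

/-- The sequence `w₀, w₁, …, wₙ` of marked words attached to a partition `π` of `[n]`. -/
def markedWord {n : ℕ} (π : Finpartition (Finset.Icc 1 n)) : ℕ → Option MarkedWord
  | 0 => some ⟨[], ∅⟩
  | i + 1 => do
    let w ← markedWord π i
    let w' ← appendLetter (i + 1) (markedRestriction π i) (markedRestriction π (i + 1)) w
    return activateMax (i + 1) (markedRestriction π (i + 1)) w'

/-- The final word `wₙ` (its marks are forgotten). -/
def finalWord {n : ℕ} (π : Finpartition (Finset.Icc 1 n)) : Option (List ℕ) :=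
  (markedWord π n).map MarkedWord.letters

/-- A partition is determined by its canonical word, so partitions of `[n]` may be identified with
their canonical words. -/
theorem canonicalWord_injective (n : ℕ) :
    Function.Injective (canonicalWord : Finpartition (Finset.Icc 1 n) → List ℕ) := by
  have key : ∀ (π : Finpartition (Finset.Icc 1 n)), ∀ i ∈ Finset.Icc 1 n, ∀ j ∈ Finset.Icc 1 n,
      (blockIndex π i = blockIndex π j ↔ j ∈ π.part i) := by
    have mono : ∀ (π : Finpartition (Finset.Icc 1 n)), ∀ i ∈ Finset.Icc 1 n,
        ∀ j ∈ Finset.Icc 1 n, (π.part i).min ≤ (π.part j).min →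
        blockIndex π i = blockIndex π j → π.part i = π.part j := by
      intro π i hi j hj hle h
      have hsub : (π.parts.filter fun B => B.min ≤ (π.part i).min) ⊆
          (π.parts.filter fun B => B.min ≤ (π.part j).min) := by
        intro B hB
        rw [Finset.mem_filter] at hB ⊢
        exact ⟨hB.1, hB.2.trans hle⟩
      have heq := Finset.eq_of_subset_of_card_le hsub (le_of_eq h.symm)
      have hj' : π.part j ∈ (π.parts.filter fun B => B.min ≤ (π.part i).min) := by
        rw [heq, Finset.mem_filter]
        exact ⟨π.part_mem.2 hj, le_rfl⟩
      have hmin := le_antisymm hle (Finset.mem_filter.1 hj').2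
      obtain ⟨a, ha⟩ := Finset.min_of_nonempty (π.part_nonempty.2 hi)
      exact π.eq_of_mem_parts (π.part_mem.2 hi) (π.part_mem.2 hj) (Finset.mem_of_min ha)
        (Finset.mem_of_min (hmin ▸ ha))
    intro π i hi j hj
    constructor
    · intro h
      have : π.part i = π.part j := by
        rcases le_total (π.part i).min (π.part j).min with hle | hle
        · exact mono π i hi j hj hle h
        · exact (mono π j hj i hi hle h.symm).symm
      rw [this]
      exact π.mem_part_self.2 hj
    · intro h
      have : π.part j = π.part i := π.part_eq_of_mem (π.part_mem.2 hi) h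
      simp only [blockIndex, this]
  intro π σ h
  have hidx : ∀ i ∈ Finset.Icc 1 n, blockIndex π i = blockIndex σ i := by
    intro i hi
    refine List.map_inj_left.1 h i ?_
    rw [Finset.mem_Icc] at hi
    rw [List.mem_range'_1]
    omega
  have hpart : ∀ i ∈ Finset.Icc 1 n, π.part i = σ.part i := by
    intro i hi
    ext j
    constructor
    · intro hj
      have hj' := π.part_subset i hj
      rw [← key σ i hi j hj', ← hidx i hi, ← hidx j hj', key π i hi j hj']
      exact hj
    · intro hj
      have hj' := σ.part_subset i hj
      rw [← key π i hi j hj', hidx i hi, hidx j hj', key σ i hi j hj']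
      exact hj
  have hsub : ∀ (α β : Finpartition (Finset.Icc 1 n)),
      (∀ i ∈ Finset.Icc 1 n, α.part i = β.part i) → α.parts ⊆ β.parts := by
    intro α β hab B hB
    obtain ⟨i, hi⟩ := α.nonempty_of_mem_parts hB
    have his := α.subset hB hi
    rw [← α.part_eq_of_mem hB hi, hab i his]
    exact β.part_mem.2 his
  exact Finpartition.ext (Finset.Subset.antisymm (hsub π σ hpart)
    (hsub σ π fun i hi => (hpart i hi).symm))

end DirectBijection

namespace DirectBijection

/-! The procedure runs two mirror-image systems side by side: the descending list `E` of active
integers and the descending list `A` of active letters. They always have the same length, and the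
integer `i` is active exactly when the current maximal letter `m` is (`Inv`). Each step is one of
three moves, followed by an optional opening of `i + 1` together with the new maximal letter. A
`History` is such a run from empty lists to empty lists.

On the integer side, 2-distant noncrossing says that when `i + 1` is joined to `e`, no active
integer except `i` exceeds `e`; so `e` is the top of `E`, or second with `i` on top. These are
precisely the moves, and noncrossing partitions are precisely the partitions with a history
(`IsDistantNoncrossing.exists_history`, `History.isDistantNoncrossing`).

On the letter side, a restricted growth word avoids 12312 exactly when no letter is followed by one
strictly between it and the earlier maximum (`avoids_iff`). The final word reveals `A`: a letter
below the maximum is active exactly when it still occurs later (`History.mem_A`), and activity of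
the maximum is decided by `Opens` (`History.max_mem_A`). So the word determines the history
(`History.unique`), which gives injectivity, and every avoiding word has one
(`RestrictedGrowth.exists_history`), which gives surjectivity. Blocks on both sides are counted by
the `new` moves (`History.card_none`). -/

/-! ### States and moves of the procedure. -/

/-- The closing half of a step: the integer `i + 1` is joined to `p` (if not `none`), the letter `x`
is appended, the descending lists `E` of active integers and `A` of active letters and the
maximal letter `m` are updated. -/
inductive Move (i : ℕ) : List ℕ → List ℕ → ℕ → Option ℕ → ℕ → List ℕ → List ℕ → ℕ → Prop
  | new (E A : List ℕ) (m : ℕ) : Move i E A m none (m + 1) E A (m + 1)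
  | top (e : ℕ) (E : List ℕ) (a : ℕ) (A : List ℕ) (m : ℕ) :
      Move i (e :: E) (a :: A) m (some e) a E A m
  -- The two sides differ here: the second integer `e` is closed and `i` survives, whereas the top
  -- letter `m` is dropped and the second letter `a`, though written, survives.
  | second (e : ℕ) (E : List ℕ) (a : ℕ) (A : List ℕ) (m : ℕ) :
      Move i (i :: e :: E) (m :: a :: A) m (some e) a (i :: E) (a :: A) m

/-- A full step: a closing half, after which `i + 1` and the maximal letter may be made active. -/
def Step (i : ℕ) (E A : List ℕ) (m : ℕ) (p : Option ℕ) (x : ℕ) (E' A' : List ℕ) (m' : ℕ) : Prop :=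
  ∃ E₁ A₁, Move i E A m p x E₁ A₁ m' ∧
    ((E' = E₁ ∧ A' = A₁) ∨ (E' = (i + 1) :: E₁ ∧ A' = m' :: A₁))

/-- What holds between the active integers, the active letters and the maximal letter. -/
structure Inv (i : ℕ) (E A : List ℕ) (m : ℕ) : Prop where
  pairwiseE : E.Pairwise (· > ·)
  boundE : ∀ e ∈ E, 1 ≤ e ∧ e ≤ i
  pairwiseA : A.Pairwise (· > ·)
  boundA : ∀ a ∈ A, 1 ≤ a ∧ a ≤ m
  length_eq : E.length = A.length
  -- This is what lets a `second` move be recognised from either side alone.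
  top_iff : i ∈ E ↔ m ∈ A

/-- After the closing half every active letter is strictly below `m'` and every active integer is at
most `i`. Hence the opening adds a new head to both lists or to neither, which restores `top_iff`.
-/
theorem Inv.step {i m x m' : ℕ} {E A E' A' : List ℕ} {p : Option ℕ} (h : Inv i E A m)
    (s : Step i E A m p x E' A' m') : Inv (i + 1) E' A' m' := by
  obtain ⟨E₁, A₁, hm, ho⟩ := s
  have key : E₁.Pairwise (· > ·) ∧ (∀ e ∈ E₁, 1 ≤ e ∧ e ≤ i) ∧ A₁.Pairwise (· > ·) ∧
      (∀ a ∈ A₁, 1 ≤ a ∧ a < m') ∧ E₁.length = A₁.length ∧ 1 ≤ m' := by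
    obtain ⟨h1, h2, h3, h4, h5, h6⟩ := h
    clear ho
    cases hm <;> (try simp only [List.pairwise_cons, List.mem_cons, List.length_cons,
      forall_eq_or_imp, true_or] at *) <;>
      grind
  obtain ⟨h1, h2, h3, h4, h5, h6⟩ := key
  rcases ho with ⟨rfl, rfl⟩ | ⟨rfl, rfl⟩
  · constructor <;> grind
  · constructor <;>
      (try simp only [List.pairwise_cons, List.mem_cons, List.length_cons,
      forall_eq_or_imp, true_or] at *) <;> grind

/-- The sequence of all the steps of the procedure: `p i` is the integer to which `i + 1` is joined,
`x i` the letter number `i + 1` of the word. -/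
structure History (n : ℕ) (p : ℕ → Option ℕ) (x : ℕ → ℕ) (E A : ℕ → List ℕ) (m : ℕ → ℕ) :
    Prop where
  zeroE : E 0 = []
  zeroA : A 0 = []
  zero_max : m 0 = 0
  lastA : A n = []
  step : ∀ i < n, Step i (E i) (A i) (m i) (p i) (x i) (E (i + 1)) (A (i + 1)) (m (i + 1))

/-- `m i` is the maximum of the first `i` letters, and each letter exceeds the maximum of the
preceding ones by at most one. -/
structure RestrictedGrowth (n : ℕ) (x m : ℕ → ℕ) : Prop where
  zero : m 0 = 0
  pos : ∀ i < n, 1 ≤ x i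
  le : ∀ i < n, x i ≤ m i + 1
  succ : ∀ i < n, m (i + 1) = max (m i) (x i)

/-- Whether the maximal letter is active before the letter `x i` is appended. -/
def Opens (n : ℕ) (x m : ℕ → ℕ) (i : ℕ) : Prop :=
  x i = m i ∨ (x i = m i + 1 ∧ ∃ j, i < j ∧ j < n ∧ x j = m i) ∨
    (x i < m i ∧ ∃ j, i < j ∧ j < n ∧ x j = x i)

/-! ### What the word of a history reveals. -/

namespace History

variable {n : ℕ} {p : ℕ → Option ℕ} {x : ℕ → ℕ} {E A : ℕ → List ℕ} {m : ℕ → ℕ}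

theorem inv (h : History n p x E A m) : ∀ i ≤ n, Inv i (E i) (A i) (m i) := by
  intro i
  induction i with
  | zero =>
    intro _
    rw [h.zeroE, h.zeroA, h.zero_max]
    constructor <;> simp
  | succ i ih => exact fun hi => (ih (by omega)).step (h.step i (by omega))

theorem restrictedGrowth (h : History n p x E A m) : RestrictedGrowth n x m := by
  refine ⟨h.zero_max, ?_, ?_, ?_⟩ <;> intro i hi <;> have hI := h.inv i hi.le <;>
    have hs := h.step i hi <;> obtain ⟨h1, h2, h3, h4, h5, h6⟩ := hI <;>
    obtain ⟨E₁, A₁, hm, -⟩ := hs <;> generalize A i = a at * <;> generalize E i = e at * <;>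
    generalize m i = mi at * <;> generalize x i = xi at * <;> generalize p i = pi at * <;>
    generalize m (i + 1) = mi' at * <;> cases hm <;>
    (try simp only [List.pairwise_cons, List.mem_cons, List.length_cons,
      forall_eq_or_imp, true_or] at *) <;> grind

theorem lastE (h : History n p x E A m) : E n = [] := by
  have := (h.inv n le_rfl).length_eq
  rw [h.lastA] at this
  simpa using this

/-- Once below the maximum, a letter is never activated again, is active whenever it is written, and
is deactivated only by being written. As `A n` is empty, it is active exactly when it still has to
be written. The maximum itself is excluded because a `second` move drops it unwritten. -/
theorem mem_A (h : History n p x E A m) {i : ℕ} (hi : i ≤ n) :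
    ∀ a < m i, a ∈ A i ↔ ∃ j, i ≤ j ∧ j < n ∧ x j = a := by
  induction hi using Nat.decreasingInduction with
  | self =>
    intro a _
    rw [h.lastA]
    constructor
    · simp
    · rintro ⟨j, h1, h2, -⟩
      omega
  | of_succ i hi ih =>
    intro a ha
    have hm := h.restrictedGrowth.succ i hi
    have hex : (∃ j, i ≤ j ∧ j < n ∧ x j = a) ↔ x i = a ∨ ∃ j, i + 1 ≤ j ∧ j < n ∧ x j = a := by
      constructor
      · rintro ⟨j, h1, h2, h3⟩
        rcases h1.eq_or_lt with rfl | h1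
        · exact Or.inl h3
        · exact Or.inr ⟨j, h1, h2, h3⟩
      · rintro (h1 | ⟨j, h1, h2, h3⟩)
        · exact ⟨i, le_rfl, hi, h1⟩
        · exact ⟨j, by omega, h2, h3⟩
    rw [hex, ← ih a (by omega)]
    obtain ⟨h1, h2, h3, h4, h5, h6⟩ := h.inv i hi.le
    obtain ⟨E₁, A₁, hmv, ho⟩ := h.step i hi
    generalize A i = b at *
    generalize E i = e at *
    generalize A (i + 1) = b' at *
    generalize E (i + 1) = e' at *
    generalize m i = mi at *
    generalize x i = xi at *
    generalize p i = pi at *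
    generalize m (i + 1) = mi' at *
    cases hmv <;> (try simp only [List.pairwise_cons, List.mem_cons, List.length_cons,
      forall_eq_or_imp, true_or] at *) <;>
    grind

/-- Read off from the next move: writing `m i` is a `top` move with `m i` on top; after a `new` move
`m i` lies below the maximum, so `mem_A` decides; and writing a smaller letter is `second` (so `m i`
was active) or `top` according to whether that letter stays active, that is, recurs. -/
theorem max_mem_A (h : History n p x E A m) {i : ℕ} (hi : i < n) :
    m i ∈ A i ↔ Opens n x m i := by
  have hex : ∀ a < m (i + 1), a ∈ A (i + 1) ↔ ∃ j, i < j ∧ j < n ∧ x j = a :=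
    h.mem_A (i := i + 1) hi
  have hm := h.restrictedGrowth.succ i hi
  have e1 : Opens n x m i ↔ x i = m i ∨ (x i = m i + 1 ∧ m i ∈ A (i + 1)) ∨
      (x i < m i ∧ x i ∈ A (i + 1)) := by
    unfold Opens
    refine or_congr_right (or_congr (and_congr_right fun h1 => ?_) (and_congr_right fun h1 => ?_))
    · exact (hex _ (by omega)).symm
    · exact (hex _ (by omega)).symm
  rw [e1]
  obtain ⟨h1, h2, h3, h4, h5, h6⟩ := h.inv i hi.le
  obtain ⟨E₁, A₁, hmv, ho⟩ := h.step i hi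
  clear hex e1
  generalize A i = b at *
  generalize E i = e at *
  generalize A (i + 1) = b' at *
  generalize E (i + 1) = e' at *
  generalize m i = mi at *
  generalize x i = xi at *
  generalize p i = pi at *
  generalize m (i + 1) = mi' at *
  cases hmv <;> (try simp only [List.pairwise_cons, List.mem_cons, List.length_cons,
      forall_eq_or_imp, true_or, true_iff] at *) <;>
    grind

/-- Such a letter `x k` would be active at time `j` by `mem_A`, but a move never writes a letter
with an active letter strictly between it and the maximum. -/
theorem avoiding (h : History n p x E A m) :
    ∀ j k, j < k → k < n → ¬ (x j < x k ∧ x k < m j) := by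
  rintro j k hjk hk ⟨h1, h2⟩
  have hb : x k ∈ A j := (h.mem_A (by omega) _ h2).2 ⟨k, hjk.le, hk, rfl⟩
  obtain ⟨i1, i2, i3, i4, i5, i6⟩ := h.inv j (by omega)
  obtain ⟨E₁, A₁, hmv, -⟩ := h.step j (by omega)
  generalize A j = b at *
  generalize E j = e at *
  generalize m j = mi at *
  generalize x j = xi at *
  generalize p j = pj at *
  generalize m (j + 1) = mi' at *
  cases hmv <;> (try simp only [List.pairwise_cons, List.mem_cons, List.length_cons,
      forall_eq_or_imp, true_or] at *) <;>
    grind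

end History

/-! ### The word determines the history. -/

theorem RestrictedGrowth.unique {n : ℕ} {x x' m m' : ℕ → ℕ} (h : RestrictedGrowth n x m)
    (h' : RestrictedGrowth n x' m') (hx : ∀ i < n, x i = x' i) : ∀ i ≤ n, m i = m' i := by
  intro i
  induction i with
  | zero => intro _; rw [h.zero, h'.zero]
  | succ i ih => intro hi; rw [h.succ i hi, h'.succ i hi, ih (by omega), hx i hi]

theorem Opens.congr {n : ℕ} {x x' m m' : ℕ → ℕ} (hx : ∀ i < n, x i = x' i) {i : ℕ} (hi : i < n)
    (hm : m i = m' i) : Opens n x m i ↔ Opens n x' m' i := by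
  unfold Opens
  rw [hx i hi, hm]
  refine or_congr_right (or_congr (and_congr_right fun h1 => ?_) (and_congr_right fun h1 => ?_)) <;>
    refine exists_congr fun j => and_congr_right fun _ => and_congr_right fun hj => by rw [hx j hj]

/-- The move is determined by the letters: only `new` raises the maximum, and `top` writes the head
of the strictly decreasing list `A` while `second` writes its second entry. The length of `A'` tells
whether there was an opening. -/
theorem Step.unique {i m m' x : ℕ} {E A A' E' F' : List ℕ} {p q : Option ℕ}
    (hI : Inv i E A m) (h : Step i E A m p x E' A' m') (h' : Step i E A m q x F' A' m') :
    p = q ∧ E' = F' := by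
  obtain ⟨E₁, A₁, hm, ho⟩ := h
  obtain ⟨E₂, A₂, hm', ho'⟩ := h'
  have key : p = q ∧ E₁ = E₂ ∧ A₁ = A₂ := by
    obtain ⟨h1, h2, h3, h4, h5, h6⟩ := hI
    clear ho ho'
    cases hm <;> cases hm' <;>
      (try simp only [List.pairwise_cons, List.mem_cons, List.length_cons,
      forall_eq_or_imp, true_or] at *) <;>
      grind
  obtain ⟨rfl, rfl, rfl⟩ := key
  refine ⟨rfl, ?_⟩
  rcases ho with ⟨rfl, h1⟩ | ⟨rfl, h1⟩ <;> rcases ho' with ⟨rfl, h2⟩ | ⟨rfl, h2⟩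
  · rfl
  · have := congrArg List.length (h1.symm.trans h2); simp at this
  · have := congrArg List.length (h1.symm.trans h2); simp at this
  · rfl

/-- The lists of letters agree because `mem_A` and `max_mem_A` express them through the word; the
integers then agree by forward induction with `Step.unique`. -/
theorem History.unique {n : ℕ} {p q : ℕ → Option ℕ} {x y : ℕ → ℕ} {E A F B : ℕ → List ℕ}
    {m k : ℕ → ℕ} (h : History n p x E A m) (h' : History n q y F B k)
    (hx : ∀ i < n, x i = y i) : ∀ i < n, p i = q i := by
  have hm := h.restrictedGrowth.unique h'.restrictedGrowth hx
  have hA : ∀ i ≤ n, A i = B i := by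
    intro i hi
    rcases hi.eq_or_lt with rfl | hi
    · rw [h.lastA, h'.lastA]
    have hI := h.inv i hi.le
    have hI' := h'.inv i hi.le
    refine hI.pairwiseA.sortedGT.eq_of_mem_iff hI'.pairwiseA.sortedGT fun a => ?_
    rcases lt_trichotomy a (m i) with ha | rfl | ha
    · rw [h.mem_A hi.le a ha, h'.mem_A hi.le a (hm i hi.le ▸ ha)]
      exact exists_congr fun j => and_congr_right fun _ => and_congr_right fun hj => by rw [hx j hj]
    · rw [h.max_mem_A hi, hm i hi.le, h'.max_mem_A hi]
      exact Opens.congr hx hi (hm i hi.le)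
    · have h1 : a ∉ A i := fun h1 => by have := hI.boundA a h1; omega
      have h2 : a ∉ B i := fun h1 => by have := hI'.boundA a h1; have := hm i hi.le; omega
      simp only [h1, h2]
  have hE : ∀ i ≤ n, E i = F i := by
    intro i
    induction i with
    | zero => intro _; rw [h.zeroE, h'.zeroE]
    | succ i ih =>
      intro hi
      have s' := h'.step i hi
      rw [← ih (by omega), ← hA i (by omega), ← hA _ hi, ← hm i (by omega), ← hm _ hi,
        ← hx i hi] at s'
      exact (Step.unique (h.inv i (by omega)) (h.step i hi) s').2
  intro i hi
  have s' := h'.step i hi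
  rw [← hE i hi.le, ← hA i hi.le, ← hA _ hi, ← hm i hi.le, ← hm _ hi, ← hx i hi] at s'
  exact (Step.unique (h.inv i hi.le) (h.step i hi) s').1

theorem Inv.mem_of_step {i m x m' : ℕ} {E A E' A' : List ℕ} {p : Option ℕ} (h : Inv i E A m)
    (s : Step i E A m p x E' A' m') {e : ℕ} (he : p = some e) :
    1 ≤ e ∧ e ≤ i ∧ e ∈ E ∧ e ∉ E' := by
  obtain ⟨E₁, A₁, hm, ho⟩ := s
  obtain ⟨h1, h2, h3, h4, h5, h6⟩ := h
  cases hm <;> (try simp only [List.pairwise_cons, List.mem_cons, List.length_cons,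
      forall_eq_or_imp, true_or] at *) <;> grind

/-! ### Existence of histories, from letters or from integers. -/

/-- A sequence of states exists if each state has a successor. -/
theorem exists_sequence {α : Type*} (P : ℕ → α → Prop) (R : ℕ → α → α → Prop) {a : α}
    (h0 : P 0 a) (h : ∀ i s, P i s → ∃ s', P (i + 1) s' ∧ R i s s') :
    ∃ s : ℕ → α, s 0 = a ∧ ∀ i, P i (s i) ∧ R i (s i) (s (i + 1)) := by
  choose! g hg using h
  let s : ℕ → α := fun i => Nat.rec a (fun i b => g i b) i
  have hs : ∀ i, P i (s i) := by
    intro i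
    induction i with
    | zero => exact h0
    | succ i ih => exact (hg i _ ih).1
  exact ⟨s, rfl, fun i => ⟨hs i, (hg i _ (hs i)).2⟩⟩

theorem History.mem_E {n : ℕ} {p : ℕ → Option ℕ} {x : ℕ → ℕ} {E A : ℕ → List ℕ} {m : ℕ → ℕ}
    (h : History n p x E A m) {i : ℕ} (hi : i ≤ n) :
    ∀ e, e ∈ E i ↔ e ≤ i ∧ ∃ j, i ≤ j ∧ j < n ∧ p j = some e := by
  induction hi using Nat.decreasingInduction with
  | self =>
    intro e
    rw [h.lastE]
    simp only [List.not_mem_nil, false_iff]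
    rintro ⟨-, j, h1, h2, -⟩
    omega
  | of_succ i hi ih =>
    intro e
    have hex : (∃ j, i ≤ j ∧ j < n ∧ p j = some e) ↔
        p i = some e ∨ ∃ j, i + 1 ≤ j ∧ j < n ∧ p j = some e := by
      constructor
      · rintro ⟨j, h1, h2, h3⟩
        rcases h1.eq_or_lt with rfl | h1
        · exact Or.inl h3
        · exact Or.inr ⟨j, h1, h2, h3⟩
      · rintro (h1 | ⟨j, h1, h2, h3⟩)
        · exact ⟨i, le_rfl, hi, h1⟩
        · exact ⟨j, by omega, h2, h3⟩
    have key : e ∈ E i ↔ e ≤ i ∧ (p i = some e ∨ e ∈ E (i + 1)) := by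
      obtain ⟨h1, h2, h3, h4, h5, h6⟩ := h.inv i hi.le
      obtain ⟨E₁, A₁, hmv, ho⟩ := h.step i hi
      clear ih hex
      generalize A i = b at *
      generalize E i = f at *
      generalize A (i + 1) = b' at *
      generalize E (i + 1) = f' at *
      generalize m i = mi at *
      generalize x i = xi at *
      generalize p i = pi at *
      generalize m (i + 1) = mi' at *
      cases hmv <;> (try simp only [List.pairwise_cons, List.mem_cons, List.length_cons,
        forall_eq_or_imp, true_or] at *) <;> grind
    rw [key, ih e, hex]
    refine and_congr_right fun h1 => or_congr_right ?_
    exact and_iff_right (by omega)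

/-- The number of integers not joined to a smaller one is the maximal letter. -/
theorem History.card_none {n : ℕ} {p : ℕ → Option ℕ} {x : ℕ → ℕ} {E A : ℕ → List ℕ} {m : ℕ → ℕ}
    (h : History n p x E A m) :
    ∀ i ≤ n, m i = ((Finset.range i).filter fun j => p j = none).card := by
  intro i
  induction i with
  | zero => intro _; simp [h.zero_max]
  | succ i ih =>
    intro hi
    rw [Finset.range_add_one, Finset.filter_insert]
    obtain ⟨E₁, A₁, hmv, -⟩ := h.step i hi
    have key : m (i + 1) = if p i = none then m i + 1 else m i := by
      generalize A i = b at *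
      generalize E i = f at *
      generalize m i = mi at *
      generalize x i = xi at *
      generalize p i = pi at *
      generalize m (i + 1) = mi' at *
      cases hmv <;> simp
    rw [key]
    split_ifs with hp
    · rw [Finset.card_insert_of_notMem (by simp), ih (by omega)]
    · exact ih (by omega)

/-- The letter half of a move can always be mirrored on the integers: equal lengths supply the
needed entries, and in the `second` case `top_iff` together with the bound forces `i` to be the head
of `E`. -/
theorem Inv.exists_step_of_letters {i m x m' : ℕ} {E A A₁ A' : List ℕ} (h : Inv i E A m)
    (hm : (x = m + 1 ∧ A = A₁ ∧ m' = m + 1) ∨ (A = x :: A₁ ∧ m' = m) ∨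
      (∃ B, A = m :: x :: B ∧ A₁ = x :: B ∧ m' = m))
    (ho : A' = A₁ ∨ A' = m' :: A₁) : ∃ p E', Step i E A m p x E' A' m' := by
  have key : ∃ p E₁, Move i E A m p x E₁ A₁ m' := by
    have hl := h.length_eq
    rcases hm with ⟨rfl, rfl, rfl⟩ | ⟨rfl, rfl⟩ | ⟨B, rfl, rfl, rfl⟩
    · exact ⟨_, _, Move.new _ _ _⟩
    · obtain _ | ⟨e, E⟩ := E
      · simp at hl
      · exact ⟨_, _, Move.top _ _ _ _ _⟩
    · have hi : i ∈ E := h.top_iff.2 (by simp)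
      obtain _ | ⟨f, _ | ⟨e, E⟩⟩ := E
      · simp at hl
      · simp at hl
      · have hf : i = f := by
          have h1 := h.pairwiseE
          have h2 := h.boundE f (by simp)
          simp only [List.pairwise_cons, List.mem_cons] at h1 hi
          grind
        subst hf
        exact ⟨_, _, Move.second _ _ _ _ _⟩
  obtain ⟨p, E₁, hm⟩ := key
  rcases ho with rfl | rfl
  · exact ⟨p, E₁, E₁, _, hm, Or.inl ⟨rfl, rfl⟩⟩
  · exact ⟨p, (i + 1) :: E₁, E₁, _, hm, Or.inr ⟨rfl, rfl⟩⟩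

theorem Inv.exists_step_of_integers {i m : ℕ} {p : Option ℕ} {E A E₁ E' : List ℕ}
    (h : Inv i E A m)
    (hm : (p = none ∧ E = E₁) ∨ (∃ e, p = some e ∧ E = e :: E₁) ∨
      (∃ e F, p = some e ∧ E = i :: e :: F ∧ E₁ = i :: F))
    (ho : E' = E₁ ∨ E' = (i + 1) :: E₁) :
    ∃ x A' m', Step i E A m p x E' A' m' := by
  have key : ∃ x A₁ m', Move i E A m p x E₁ A₁ m' := by
    have hl := h.length_eq
    rcases hm with ⟨rfl, rfl⟩ | ⟨e, rfl, rfl⟩ | ⟨e, F, rfl, rfl, rfl⟩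
    · exact ⟨_, _, _, Move.new _ _ _⟩
    · obtain _ | ⟨a, A⟩ := A
      · simp at hl
      · exact ⟨_, _, _, Move.top _ _ _ _ _⟩
    · have hi : m ∈ A := h.top_iff.1 (by simp)
      obtain _ | ⟨f, _ | ⟨a, A⟩⟩ := A
      · simp at hl
      · simp at hl
      · have hf : m = f := by
          have h1 := h.pairwiseA
          have h2 := h.boundA f (by simp)
          simp only [List.pairwise_cons, List.mem_cons] at h1 hi
          grind
        subst hf
        exact ⟨_, _, _, Move.second _ _ _ _ _⟩
  obtain ⟨x, A₁, m', hm⟩ := key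
  rcases ho with rfl | rfl
  · exact ⟨x, A₁, m', _, A₁, hm, Or.inl ⟨rfl, rfl⟩⟩
  · exact ⟨x, m' :: A₁, m', _, A₁, hm, Or.inr ⟨rfl, rfl⟩⟩

/-- The letters less than the maximum of the first `i` letters that occur later on. -/
noncomputable def recurring (n : ℕ) (x m : ℕ → ℕ) (i : ℕ) : List ℕ :=
  open Classical in
  ((Finset.range (m i)).filter fun a => ∃ j, i ≤ j ∧ j < n ∧ x j = a).sort (· ≥ ·)

theorem mem_recurring {n : ℕ} {x m : ℕ → ℕ} {i a : ℕ} :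
    a ∈ recurring n x m i ↔ a < m i ∧ ∃ j, i ≤ j ∧ j < n ∧ x j = a := by
  simp [recurring]

theorem sortedGT_recurring (n : ℕ) (x m : ℕ → ℕ) (i : ℕ) : (recurring n x m i).SortedGT :=
  Finset.sortedGT_sort _

/-- The active letters, read off from the final word. -/
noncomputable def activeLetters (n : ℕ) (x m : ℕ → ℕ) (i : ℕ) : List ℕ :=
  open Classical in
  if i < n ∧ Opens n x m i then m i :: recurring n x m i else recurring n x m i

/-- The candidate lists read off from the word change as a move prescribes; `recurring n x m (i +
1)` is the list after the closing half, before any opening. -/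
theorem RestrictedGrowth.activeLetters_cases {n : ℕ} {x m : ℕ → ℕ} (h : RestrictedGrowth n x m)
    (ha : ∀ j k, j < k → k < n → ¬ (x j < x k ∧ x k < m j)) {i : ℕ} (hi : i < n) :
    (x i = m i + 1 ∧ activeLetters n x m i = recurring n x m (i + 1) ∧ m (i + 1) = m i + 1) ∨
      (activeLetters n x m i = x i :: recurring n x m (i + 1) ∧ m (i + 1) = m i) ∨
      (∃ B, activeLetters n x m i = m i :: x i :: B ∧ recurring n x m (i + 1) = x i :: B ∧
        m (i + 1) = m i) := by
  have hs := h.succ i hi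
  have hle := h.le i hi
  have hpos := h.pos i hi
  have hrec : ∀ a, a ∈ recurring n x m (i + 1) ↔ a < m (i + 1) ∧ ∃ j, i < j ∧ j < n ∧ x j = a :=
    fun a => mem_recurring
  have hocc : ∀ a, (∃ j, i ≤ j ∧ j < n ∧ x j = a) ↔ x i = a ∨ ∃ j, i < j ∧ j < n ∧ x j = a := by
    intro a
    constructor
    · rintro ⟨j, h1, h2, h3⟩
      rcases h1.eq_or_lt with rfl | h1
      · exact Or.inl h3
      · exact Or.inr ⟨j, h1, h2, h3⟩
    · rintro (h1 | ⟨j, h1, h2, h3⟩)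
      · exact ⟨i, le_rfl, hi, h1⟩
      · exact ⟨j, by omega, h2, h3⟩
  have hrec' : ∀ a, a ∈ recurring n x m i ↔ a < m i ∧ (x i = a ∨ ∃ j, i < j ∧ j < n ∧ x j = a) :=
    fun a => by rw [mem_recurring, hocc]
  have sA := sortedGT_recurring n x m i
  have sB := sortedGT_recurring n x m (i + 1)
  rcases lt_trichotomy (x i) (m i) with hx | hx | hx
  · have hm : m (i + 1) = m i := by omega
    -- Avoidance makes `x i` the largest recurring letter: a larger one below `m i` would be written
    -- later, strictly between `x i` and `m i`.
    obtain ⟨B, hB⟩ : ∃ B, recurring n x m i = x i :: B := by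
      have hmem : x i ∈ recurring n x m i := (hrec' _).2 ⟨hx, Or.inl rfl⟩
      rcases hr : recurring n x m i with _ | ⟨b, B⟩
      · simp [hr] at hmem
      · have hb : b ∈ recurring n x m i := by simp [hr]
        rw [hr] at hmem sA
        have h1 := sA.pairwise
        simp only [List.pairwise_cons, List.mem_cons] at h1 hmem
        obtain ⟨h2, h3⟩ := (hrec' b).1 hb
        rcases h3 with h3 | ⟨j, h3, h4, h5⟩
        · exact ⟨B, by rw [h3]⟩
        · rcases hmem with h6 | h6
          · exact ⟨B, by rw [h6]⟩
          · exact absurd ⟨by have := h1.1 _ h6; omega, by omega⟩ (ha i j h3 h4)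
    have hpw := (hB ▸ sA).pairwise
    rw [List.pairwise_cons] at hpw
    -- If `x i` recurs it must stay active, so the move is `second` with `m i` on top; otherwise it
    -- is `top`.
    by_cases hl : ∃ j, i < j ∧ j < n ∧ x j = x i
    · refine Or.inr (Or.inr ⟨B, ?_, ?_, hm⟩)
      · rw [activeLetters, if_pos ⟨hi, Or.inr (Or.inr ⟨hx, hl⟩)⟩, hB]
      · rw [← hB]
        refine sB.eq_of_mem_iff sA fun a => ?_
        rw [hrec, hrec', hm]
        grind
    · refine Or.inr (Or.inl ⟨?_, hm⟩)
      have : ¬ Opens n x m i := by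
        rintro (h1 | ⟨h1, -⟩ | ⟨-, h1⟩)
        · omega
        · omega
        · exact hl h1
      rw [activeLetters, if_neg (fun h1 => this h1.2), hB]
      congr 1
      refine hpw.2.sortedGT.eq_of_mem_iff sB fun a => ?_
      have h1 := hrec' a
      rw [hB, List.mem_cons] at h1
      rw [hrec, hm]
      constructor
      · intro h2
        have h3 := hpw.1 a h2
        obtain ⟨h4, h5⟩ := h1.1 (Or.inr h2)
        exact ⟨h4, h5.resolve_left (by omega)⟩
      · rintro ⟨h2, h3⟩
        rcases h1.2 ⟨h2, Or.inr h3⟩ with rfl | h4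
        · exact absurd h3 hl
        · exact h4
  · have hm : m (i + 1) = m i := by omega
    refine Or.inr (Or.inl ⟨?_, hm⟩)
    rw [activeLetters, if_pos ⟨hi, Or.inl hx⟩, hx]
    congr 1
    refine sA.eq_of_mem_iff sB fun a => ?_
    rw [hrec, hrec', hm]
    refine and_congr_right fun h1 => or_iff_right (by omega)
  · have hx' : x i = m i + 1 := by omega
    have hm : m (i + 1) = m i + 1 := by omega
    refine Or.inl ⟨hx', ?_, hm⟩
    rw [activeLetters]
    split_ifs with ho
    · refine List.SortedGT.eq_of_mem_iff (List.pairwise_cons.2 ⟨fun a h1 => ?_, sA.pairwise⟩).sortedGT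
        sB fun a => ?_
      · exact ((hrec' a).1 h1).1
      · have hl : ∃ j, i < j ∧ j < n ∧ x j = m i := by
          rcases ho.2 with h1 | ⟨-, h1⟩ | ⟨h1, -⟩
          · omega
          · exact h1
          · omega
        rw [List.mem_cons, hrec, hrec', hm]
        grind
    · refine sA.eq_of_mem_iff sB fun a => ?_
      have hl : ¬ ∃ j, i < j ∧ j < n ∧ x j = m i := fun h1 => ho ⟨hi, Or.inr (Or.inl ⟨hx', h1⟩)⟩
      rw [hrec, hrec', hm]
      grind

/-- A restricted growth word without the forbidden pattern is the outcome of the procedure. -/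
theorem RestrictedGrowth.exists_history {n : ℕ} {x m : ℕ → ℕ} (h : RestrictedGrowth n x m)
    (ha : ∀ j k, j < k → k < n → ¬ (x j < x k ∧ x k < m j)) :
    ∃ p E A, History n p x E A m := by
  refine (exists_sequence
    (fun i E => i ≤ n → Inv i E (activeLetters n x m i) (m i))
    (fun i E E' => ∃ p, i < n → Step i E (activeLetters n x m i) (m i) p (x i) E'
      (activeLetters n x m (i + 1)) (m (i + 1))) (a := []) ?_ ?_).elim fun E h_seq => ?_
  · intro _
    have h1 : activeLetters n x m 0 = [] := by
      have h2 : recurring n x m 0 = [] :=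
        List.eq_nil_iff_forall_not_mem.2 fun a h1 => by
          have := (mem_recurring.1 h1).1
          rw [h.zero] at this
          omega
      rw [activeLetters, if_neg, h2]
      rintro ⟨h3, h4⟩
      have h5 := h.pos 0 h3
      rw [Opens, h.zero] at h4
      rcases h4 with h4 | ⟨-, j, -, h6, h7⟩ | ⟨h4, -⟩
      · omega
      · have := h.pos j h6
        omega
      · omega
    rw [h1, h.zero]
    constructor <;> simp
  · intro i E hI
    by_cases hi : i < n
    · have hI := hI hi.le
      obtain ⟨p, E', hs⟩ := hI.exists_step_of_letters (h.activeLetters_cases ha hi)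
        (A' := activeLetters n x m (i + 1)) (by rw [activeLetters]; split_ifs <;> simp)
      exact ⟨E', fun _ => hI.step hs, p, fun _ => hs⟩
    · exact ⟨E, fun h1 => absurd h1 (by omega), none, fun h1 => absurd h1 hi⟩
  · obtain ⟨hE0, hE⟩ := h_seq
    choose hI p hp using hE
    refine ⟨p, E, activeLetters n x m, hE0, ?_, h.zero, ?_, hp⟩
    · have h1 := (hI 0 (by omega)).length_eq
      rw [hE0] at h1
      exact List.eq_nil_of_length_eq_zero h1.symm
    · rw [activeLetters, if_neg (by omega)]
      refine List.eq_nil_iff_forall_not_mem.2 fun a h1 => ?_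
      obtain ⟨-, j, h2, h3, -⟩ := mem_recurring.1 h1
      omega

/-- A sequence of lists of active integers, changing as the procedure expects, gives rise to a
word. -/
theorem exists_history_of_integers {n : ℕ} {p : ℕ → Option ℕ} {E : ℕ → List ℕ} (h0 : E 0 = [])
    (hn : E n = [])
    (h : ∀ i < n, ∃ E₁, ((p i = none ∧ E i = E₁) ∨ (∃ e, p i = some e ∧ E i = e :: E₁) ∨
      (∃ e F, p i = some e ∧ E i = i :: e :: F ∧ E₁ = i :: F)) ∧
      (E (i + 1) = E₁ ∨ E (i + 1) = (i + 1) :: E₁)) :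
    ∃ x A m, History n p x E A m := by
  refine (exists_sequence (α := List ℕ × ℕ)
    (fun i s => i ≤ n → Inv i (E i) s.1 s.2)
    (fun i s s' => ∃ x, i < n → Step i (E i) s.1 s.2 (p i) x (E (i + 1)) s'.1 s'.2)
    (a := ([], 0)) ?_ ?_).elim fun s h_seq => ?_
  · intro _
    rw [h0]
    constructor <;> simp
  · intro i s hI
    by_cases hi : i < n
    · have hI := hI hi.le
      obtain ⟨E₁, h1, h2⟩ := h i hi
      obtain ⟨x, A', m', hs⟩ := hI.exists_step_of_integers h1 h2
      exact ⟨(A', m'), fun _ => hI.step hs, x, fun _ => hs⟩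
    · exact ⟨s, fun h1 => absurd h1 (by omega), 0, fun h1 => absurd h1 hi⟩
  · obtain ⟨hs0, hs⟩ := h_seq
    choose hI x hx using hs
    refine ⟨x, fun i => (s i).1, fun i => (s i).2, h0, by simp [hs0], by simp [hs0], ?_, hx⟩
    have h1 := (hI n le_rfl).length_eq
    rw [hn] at h1
    exact List.eq_nil_of_length_eq_zero h1.symm

/-! ### Partitions and the edges of their diagrams. -/

section Finpartition

variable {n : ℕ}

theorem IsEdge.mem {s : Finset ℕ} {π : Finpartition s} {i j : ℕ} (h : IsEdge π i j) :
    i ∈ s ∧ j ∈ s := by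
  obtain ⟨-, B, hB, hi, hj, -⟩ := h
  exact ⟨π.subset hB hi, π.subset hB hj⟩

theorem IsEdge.eq_of_right {s : Finset ℕ} {π : Finpartition s} {i j k : ℕ} (h : IsEdge π i k)
    (h' : IsEdge π j k) : i = j := by
  obtain ⟨h1, B, hB, hi, hk, hn⟩ := h
  obtain ⟨h2, C, hC, hj, hk', hn'⟩ := h'
  obtain rfl := π.eq_of_mem_parts hB hC hk hk'
  have := hn j hj
  have := hn' i hi
  omega

theorem IsEdge.eq_of_left {s : Finset ℕ} {π : Finpartition s} {i j k : ℕ} (h : IsEdge π i j)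
    (h' : IsEdge π i k) : j = k := by
  obtain ⟨h1, B, hB, hi, hk, hn⟩ := h
  obtain ⟨h2, C, hC, hj, hk', hn'⟩ := h'
  obtain rfl := π.eq_of_mem_parts hB hC hi hj
  have := hn k hk'
  have := hn' j hk
  omega

theorem exists_isEdge {s : Finset ℕ} {π : Finpartition s} {B : Finset ℕ} (hB : B ∈ π.parts)
    {i j : ℕ} (hi : i ∈ B) (hj : j ∈ B) (hij : i < j) : ∃ e ∈ B, i ≤ e ∧ IsEdge π e j := by
  have hne : (B.filter (· < j)).Nonempty := ⟨i, by simp [hi, hij]⟩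
  have h1 := Finset.max'_mem _ hne
  rw [Finset.mem_filter] at h1
  refine ⟨(B.filter (· < j)).max' hne, h1.1, Finset.le_max' _ _ (by simp [hi, hij]), h1.2, B, hB,
    h1.1, hj, ?_⟩
  rintro k hk ⟨h2, h3⟩
  have := Finset.le_max' (B.filter (· < j)) k (by simp [hk, h3])
  omega

/-- The integer to which `i + 1` is joined by an edge on its left. -/
noncomputable def joined {s : Finset ℕ} (π : Finpartition s) (i : ℕ) : Option ℕ :=
  open Classical in if h : ∃ e, IsEdge π e (i + 1) then some h.choose else none

theorem joined_eq_some {s : Finset ℕ} {π : Finpartition s} {i e : ℕ} :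
    joined π i = some e ↔ IsEdge π e (i + 1) := by
  unfold joined
  split_ifs with h
  · rw [Option.some_inj]
    exact ⟨fun h1 => h1 ▸ h.choose_spec, fun h1 => h.choose_spec.eq_of_right h1⟩
  · exact ⟨fun h1 => by simp at h1, fun h1 => absurd ⟨e, h1⟩ h⟩

theorem joined_eq_none {s : Finset ℕ} {π : Finpartition s} {i : ℕ} :
    joined π i = none ↔ ∀ e, ¬ IsEdge π e (i + 1) := by
  rw [Option.eq_none_iff_forall_ne_some]
  exact forall_congr' fun e => not_congr joined_eq_some

/-- Walk down the block: the predecessor of `j` in `B` is joined to `j` in both partitions, hence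
lies in `C`, and the argument repeats from there. -/
theorem part_subset_part {s : Finset ℕ} {π σ : Finpartition s}
    (h : ∀ i j, IsEdge π i j → IsEdge σ i j) :
    ∀ j, ∀ B ∈ π.parts, ∀ C ∈ σ.parts, j ∈ B → j ∈ C → ∀ i ∈ B, i < j → i ∈ C := by
  intro j
  induction j using Nat.strong_induction_on with
  | _ j ih =>
    intro B hB C hC hjB hjC i hi hij
    obtain ⟨e, he, hie, hej⟩ := exists_isEdge hB hi hjB hij
    obtain ⟨-, D, hD, heD, hjD, -⟩ := h e j hej
    obtain rfl := σ.eq_of_mem_parts hD hC hjD hjC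
    rcases hie.eq_or_lt with rfl | hie
    · exact heD
    · exact ih e hej.1 B hB D hD he heD i hi hie

theorem parts_subset_parts {s : Finset ℕ} {π σ : Finpartition s}
    (h : ∀ i j, IsEdge π i j ↔ IsEdge σ i j) : π.parts ⊆ σ.parts := by
  intro B hB
  obtain ⟨a, ha⟩ := π.nonempty_of_mem_parts hB
  obtain ⟨C, hC, haC⟩ := σ.exists_mem (π.subset hB ha)
  suffices hsub : ∀ (π σ : Finpartition s), (∀ i j, IsEdge π i j ↔ IsEdge σ i j) →
      ∀ B ∈ π.parts, ∀ C ∈ σ.parts, a ∈ B → a ∈ C → B ⊆ C by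
    rwa [Finset.Subset.antisymm (hsub π σ h B hB C hC ha haC)
      (hsub σ π (fun i j => (h i j).symm) C hC B hB haC ha)]
  intro π σ h B hB C hC ha haC b hb
  rcases lt_trichotomy b a with hab | rfl | hab
  · exact part_subset_part (fun i j => (h i j).1) a B hB C hC ha haC b hb hab
  · exact haC
  · obtain ⟨D, hD, hbD⟩ := σ.exists_mem (π.subset hB hb)
    have haD := part_subset_part (fun i j => (h i j).1) b B hB D hD hb hbD a ha hab
    rwa [σ.eq_of_mem_parts hC hD haC haD]

/-- A partition is determined by the edges of its diagram. -/
theorem eq_of_joined_eq {π σ : Finpartition (Finset.Icc 1 n)}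
    (h : ∀ i < n, joined π i = joined σ i) : π = σ := by
  have key : ∀ (π σ : Finpartition (Finset.Icc 1 n)), (∀ i < n, joined π i = joined σ i) →
      ∀ i j, IsEdge π i j → IsEdge σ i j := by
    intro π σ h i j hij
    have hj := hij.mem.2
    rw [Finset.mem_Icc] at hj
    obtain ⟨j, rfl⟩ := Nat.exists_eq_add_of_le' hj.1
    rw [← joined_eq_some, ← h j (by omega), joined_eq_some]
    exact hij
  have hiff : ∀ i j, IsEdge π i j ↔ IsEdge σ i j :=
    fun i j => ⟨key π σ h i j, key σ π (fun i hi => (h i hi).symm) i j⟩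
  exact Finpartition.ext (Finset.Subset.antisymm (parts_subset_parts hiff)
    (parts_subset_parts fun i j => (hiff i j).symm))

/-- Each block contains exactly one integer without an edge to its left, its minimum. -/
theorem card_parts_eq (π : Finpartition (Finset.Icc 1 n)) :
    π.parts.card = ((Finset.range n).filter fun i => joined π i = none).card := by
  symm
  refine Finset.card_bij (fun i _ => π.part (i + 1)) ?_ ?_ ?_
  · intro i hi
    rw [Finset.mem_filter, Finset.mem_range] at hi
    exact π.part_mem.2 (Finset.mem_Icc.2 (by omega))
  · have key : ∀ i j, j < n → joined π j = none → π.part (i + 1) = π.part (j + 1) → i < n →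
        ¬ i < j := by
      intro i j hj hjn h hi hij
      have hi' : i + 1 ∈ π.part (i + 1) := π.mem_part_self.2 (Finset.mem_Icc.2 (by omega))
      have hj' : j + 1 ∈ π.part (j + 1) := π.mem_part_self.2 (Finset.mem_Icc.2 (by omega))
      obtain ⟨e, -, -, he⟩ := exists_isEdge
        (π.part_mem.2 (Finset.mem_Icc.2 (by omega))) (h ▸ hi') hj' (by omega)
      exact joined_eq_none.1 hjn e he
    intro i hi j hj h
    rw [Finset.mem_filter, Finset.mem_range] at hi hj
    have := key i j hj.1 hj.2 h hi.1
    have := key j i hi.1 hi.2 h.symm hj.1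
    omega
  · intro B hB
    have hne := π.nonempty_of_mem_parts hB
    have hmem := B.min'_mem hne
    have hs := π.subset hB hmem
    rw [Finset.mem_Icc] at hs
    refine ⟨B.min' hne - 1, ?_, ?_⟩
    · rw [Finset.mem_filter, Finset.mem_range, joined_eq_none, Nat.sub_add_cancel hs.1]
      refine ⟨by omega, ?_⟩
      rintro e ⟨h1, C, hC, he, hb, -⟩
      obtain rfl := π.eq_of_mem_parts hB hC hmem hb
      have := B.min'_le e he
      omega
    · rw [Nat.sub_add_cancel hs.1]
      exact π.part_eq_of_mem hB hmem

/-- The end of the chain `j, p (j - 1), …`. -/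
def root (p : ℕ → Option ℕ) (j : ℕ) : ℕ :=
  match p (j - 1) with
  | none => j
  | some e => if _h : e < j then root p e else j
termination_by j

theorem root_none {p : ℕ → Option ℕ} {i : ℕ} (h : p i = none) : root p (i + 1) = i + 1 := by
  rw [root, Nat.add_sub_cancel, h]

theorem root_some {p : ℕ → Option ℕ} {i e : ℕ} (h : p i = some e) (he : e ≤ i) :
    root p (i + 1) = root p e := by
  rw [root, Nat.add_sub_cancel, h]
  simp only
  rw [dif_pos (by omega)]

theorem root_le (p : ℕ → Option ℕ) (j : ℕ) : root p j ≤ j := by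
  induction j using Nat.strong_induction_on with
  | _ j ih =>
    rw [root]
    split
    · exact le_rfl
    · split_ifs with h
      · exact (ih _ h).trans h.le
      · exact le_rfl

/-- Suppose `k` shares the root of `e`. It has a predecessor `f`, since otherwise its root would be
`k > e`. If `f < e`, then `e` lies under the edge from `f` to `k`, which ends earlier (outer
induction); `f = e` contradicts injectivity; if `f > e`, descend to `f` (inner induction). -/
theorem root_ne_of_between {p : ℕ → Option ℕ}
    (hp : ∀ i < n, ∀ e, p i = some e → 1 ≤ e ∧ e ≤ i)
    (hinj : ∀ i j e, i < j → j < n → p i = some e → p j ≠ some e) :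
    ∀ j < n, ∀ e, p j = some e → ∀ k, e < k → k ≤ j → root p k ≠ root p e := by
  intro j
  induction j using Nat.strong_induction_on with
  | _ j ih =>
    intro hj e he k
    induction k using Nat.strong_induction_on with
    | _ k ihk =>
      intro hek hkj h
      obtain ⟨k, rfl⟩ := Nat.exists_eq_add_of_le' (show 1 ≤ k by omega)
      rcases hk : p k with _ | f
      · rw [root_none hk] at h
        have := root_le p e
        omega
      · have hf := hp k (by omega) f hk
        rw [root_some hk hf.2] at h
        rcases lt_trichotomy f e with hfe | rfl | hfe
        · exact ih k (by omega) (by omega) f hk e hfe (by omega) h.symm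
        · exact hinj k j f (by omega) hj hk he
        · exact ihk f (by omega) hfe (by omega) h

/-- Every decreasing partial injection comes from the diagram of a partition. -/
theorem exists_joined_eq {p : ℕ → Option ℕ}
    (hp : ∀ i < n, ∀ e, p i = some e → 1 ≤ e ∧ e ≤ i)
    (hinj : ∀ i j e, i < j → j < n → p i = some e → p j ≠ some e) :
    ∃ π : Finpartition (Finset.Icc 1 n), ∀ i < n, joined π i = p i := by
  classical
  let π := Finpartition.ofSetSetoid (Setoid.ker (root p)) (Finset.Icc 1 n)
  have hmem : ∀ i j, j ∈ π.part i ↔ i ∈ Finset.Icc 1 n ∧ j ∈ Finset.Icc 1 n ∧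
      root p i = root p j := fun i j => Finpartition.mem_part_ofSetSetoid_iff_rel _
  refine ⟨π, fun i hi => ?_⟩
  have hi' : i + 1 ∈ Finset.Icc 1 n := Finset.mem_Icc.2 (by omega)
  rcases hpi : p i with _ | e
  · rw [joined_eq_none]
    rintro e ⟨h1, B, hB, he, hi1, -⟩
    rw [← π.part_eq_of_mem hB hi1, hmem] at he
    rw [root_none hpi] at he
    have := root_le p e
    omega
  · have he := hp i hi e hpi
    rw [joined_eq_some]
    refine ⟨by omega, π.part (i + 1), π.part_mem.2 hi', ?_, π.mem_part_self.2 hi', ?_⟩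
    · rw [hmem]
      exact ⟨hi', Finset.mem_Icc.2 (by omega), root_some hpi he.2⟩
    · rintro k hk ⟨h1, h2⟩
      rw [hmem, root_some hpi he.2] at hk
      exact root_ne_of_between hp hinj i hi e hpi k h1 (by omega) hk.2.2.symm

end Finpartition

/-! ### Restricted growth words. -/

namespace RestrictedGrowth

variable {n : ℕ} {x m : ℕ → ℕ}

theorem mono (h : RestrictedGrowth n x m) {i j : ℕ} (hij : i ≤ j) (hj : j ≤ n) : m i ≤ m j := by
  induction j, hij using Nat.le_induction with
  | base => exact le_rfl
  | succ j hij ih =>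
    have := ih (by omega)
    have := h.succ j (by omega)
    omega

theorem lt_max (h : RestrictedGrowth n x m) {i j : ℕ} (hij : i < j) (hj : j ≤ n) : x i ≤ m j := by
  have := h.mono (i := i + 1) (j := j) hij hj
  have := h.succ i (by omega)
  omega

/-- Every letter up to the maximum has a first occurrence, before which all letters are less. -/
theorem exists_first (h : RestrictedGrowth n x m) {i a : ℕ} (hi : i ≤ n) (ha : 1 ≤ a)
    (hai : a ≤ m i) : ∃ j < i, x j = a ∧ m j + 1 = a := by
  induction i with
  | zero => rw [h.zero] at hai; omega
  | succ i ih =>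
    rcases le_or_gt a (m i) with h1 | h1
    · obtain ⟨j, h2, h3⟩ := ih (by omega) h1
      exact ⟨j, by omega, h3⟩
    · have := h.succ i (by omega)
      have := h.le i (by omega)
      exact ⟨i, by omega, by omega, by omega⟩

/-- A restricted growth word is determined by the positions at which its letters agree. -/
theorem eq_of_pattern {y k : ℕ → ℕ} (h : RestrictedGrowth n x m) (h' : RestrictedGrowth n y k)
    (hxy : ∀ i < n, ∀ j < n, x i = x j ↔ y i = y j) : ∀ i < n, x i = y i := by
  suffices hm : ∀ i ≤ n, m i = k i ∧ ∀ j < i, x j = y j from fun i hi => (hm n le_rfl).2 i hi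
  intro i
  induction i with
  | zero => intro _; exact ⟨h.zero.trans h'.zero.symm, by simp⟩
  | succ i ih =>
    intro hi
    obtain ⟨hm, hj⟩ := ih (by omega)
    have key : x i = y i := by
      rcases le_or_gt (x i) (m i) with h1 | h1
      · obtain ⟨j, h2, h3, -⟩ := h.exists_first (by omega) (h.pos i (by omega)) h1
        rw [← h3, hj j h2]
        exact (hxy j (by omega) i (by omega)).1 h3
      · rcases le_or_gt (y i) (k i) with h2 | h2
        · obtain ⟨j, h4, h3, -⟩ := h'.exists_first (by omega) (h'.pos i (by omega)) h2
          rw [← h3, ← hj j h4]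
          exact ((hxy j (by omega) i (by omega)).2 h3).symm
        · have := h.le i (by omega)
          have := h'.le i (by omega)
          omega
    refine ⟨by rw [h.succ i (by omega), h'.succ i (by omega), hm, key], fun j hji => ?_⟩
    rcases Nat.lt_succ_iff_lt_or_eq.1 hji with h1 | rfl
    · exact hj j h1
    · exact key

end RestrictedGrowth

/-! ### Canonical words and the pattern 12312. -/

section BlockIndex

variable {n : ℕ}

/-- The number of blocks whose minimum is at most `i`. -/
def blocksUpTo (π : Finpartition (Finset.Icc 1 n)) (i : ℕ) : ℕ :=
  (π.parts.filter fun B => B.min ≤ (i : WithTop ℕ)).card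

theorem min_part_le {s : Finset ℕ} {π : Finpartition s} {i : ℕ} (hi : i ∈ s) :
    (π.part i).min ≤ (i : WithTop ℕ) :=
  Finset.min_le (π.mem_part_self.2 hi)

theorem eq_part_of_min_eq {s : Finset ℕ} {π : Finpartition s} {B : Finset ℕ} {i : ℕ}
    (hB : B ∈ π.parts) (h : B.min = (i : WithTop ℕ)) : B = π.part i :=
  (π.part_eq_of_mem hB (Finset.mem_of_min h)).symm

/-- Only the block of `i + 1` can have minimum `i + 1`, so the count of blocks rises by at most one,
and does so exactly when `i + 1` opens its block. -/
theorem blockIndex_restrictedGrowth (π : Finpartition (Finset.Icc 1 n)) :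
    RestrictedGrowth n (fun i => blockIndex π (i + 1)) (blocksUpTo π) := by
  have hle : ∀ {B : Finset ℕ} {i : ℕ}, B.min ≤ ((i + 1 : ℕ) : WithTop ℕ) →
      B.min ≤ (i : WithTop ℕ) ∨ B.min = ((i + 1 : ℕ) : WithTop ℕ) := by
    intro B i hBi
    obtain ⟨b, hb⟩ := WithTop.ne_top_iff_exists.1
      (ne_top_of_le_ne_top (WithTop.coe_ne_top (a := i + 1)) hBi)
    rw [← hb] at hBi ⊢
    have h1 : b ≤ i + 1 := WithTop.coe_le_coe.1 hBi
    rcases Nat.le_succ_iff.1 h1 with h2 | h2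
    · exact Or.inl (WithTop.coe_le_coe.2 h2)
    · exact Or.inr (congrArg _ h2)
  refine ⟨?_, ?_, ?_, ?_⟩
  · rw [blocksUpTo, Finset.card_eq_zero, Finset.filter_eq_empty_iff]
    intro B hB hmin
    obtain ⟨b, hb⟩ := Finset.min_of_nonempty (π.nonempty_of_mem_parts hB)
    have h1 := π.subset hB (Finset.mem_of_min hb)
    rw [hb] at hmin
    have h2 : b ≤ 0 := WithTop.coe_le_coe.1 hmin
    rw [Finset.mem_Icc] at h1
    omega
  · intro i hi
    exact Finset.card_pos.2 ⟨π.part (i + 1), Finset.mem_filter.2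
      ⟨π.part_mem.2 (Finset.mem_Icc.2 (by omega)), le_rfl⟩⟩
  · intro i hi
    have hi' : i + 1 ∈ Finset.Icc 1 n := Finset.mem_Icc.2 (by omega)
    refine (Finset.card_le_card (t := insert (π.part (i + 1))
      (π.parts.filter fun B => B.min ≤ (i : WithTop ℕ))) ?_).trans (Finset.card_insert_le _ _)
    intro B hB
    rw [Finset.mem_filter] at hB
    rw [Finset.mem_insert, Finset.mem_filter]
    rcases hle (hB.2.trans (min_part_le hi')) with h1 | h1
    · exact Or.inr ⟨hB.1, h1⟩
    · exact Or.inl (eq_part_of_min_eq hB.1 h1)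
  · intro i hi
    have hi' : i + 1 ∈ Finset.Icc 1 n := Finset.mem_Icc.2 (by omega)
    rcases hle (min_part_le (π := π) hi') with h1 | h1
    · rw [max_eq_left]
      · refine congrArg Finset.card (Finset.filter_congr fun B hB => ⟨fun h2 => ?_, fun h2 => ?_⟩)
        · rcases hle h2 with h3 | h3
          · exact h3
          · rw [eq_part_of_min_eq hB h3]
            exact h1
        · exact h2.trans (by norm_cast; omega)
      · refine Finset.card_le_card fun B hB => ?_
        rw [Finset.mem_filter] at hB ⊢
        exact ⟨hB.1, hB.2.trans h1⟩
    · rw [max_eq_right]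
      · simp only [blocksUpTo, blockIndex, h1]
      · refine Finset.card_le_card fun B hB => ?_
        rw [Finset.mem_filter] at hB ⊢
        rw [h1]
        exact ⟨hB.1, hB.2.trans (by norm_cast; omega)⟩

theorem blocksUpTo_self (π : Finpartition (Finset.Icc 1 n)) : blocksUpTo π n = π.parts.card := by
  rw [blocksUpTo, Finset.filter_true_of_mem]
  intro B hB
  obtain ⟨b, hb⟩ := π.nonempty_of_mem_parts hB
  exact (Finset.min_le hb).trans (WithTop.coe_le_coe.2 (Finset.mem_Icc.1 (π.subset hB hb)).2)

theorem blockIndex_eq_iff (π : Finpartition (Finset.Icc 1 n)) {i j : ℕ}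
    (hi : i ∈ Finset.Icc 1 n) (hj : j ∈ Finset.Icc 1 n) :
    blockIndex π i = blockIndex π j ↔ π.part i = π.part j := by
  constructor
  · wlog hle : (π.part i).min ≤ (π.part j).min generalizing i j
    · exact fun h => (this hj hi (le_of_not_ge hle) h.symm).symm
    intro h
    have hsub : (π.parts.filter fun B => B.min ≤ (π.part i).min) ⊆
        (π.parts.filter fun B => B.min ≤ (π.part j).min) := by
      intro B hB
      rw [Finset.mem_filter] at hB ⊢
      exact ⟨hB.1, hB.2.trans hle⟩
    have heq := Finset.eq_of_subset_of_card_le hsub (le_of_eq h.symm)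
    have hj' : π.part j ∈ (π.parts.filter fun B => B.min ≤ (π.part i).min) := by
      rw [heq, Finset.mem_filter]
      exact ⟨π.part_mem.2 hj, le_rfl⟩
    have hmin := le_antisymm hle (Finset.mem_filter.1 hj').2
    obtain ⟨a, ha⟩ := Finset.min_of_nonempty (π.part_nonempty.2 hi)
    exact π.eq_of_mem_parts (π.part_mem.2 hi) (π.part_mem.2 hj) (Finset.mem_of_min ha)
      (Finset.mem_of_min (hmin ▸ ha))
  · intro h
    simp only [blockIndex, h]

/-- Every restricted growth word is the canonical word of a partition. -/
theorem RestrictedGrowth.exists_blockIndex_eq {x m : ℕ → ℕ} (h : RestrictedGrowth n x m) :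
    ∃ π : Finpartition (Finset.Icc 1 n), ∀ i < n, blockIndex π (i + 1) = x i := by
  classical
  let π := Finpartition.ofSetSetoid (Setoid.ker fun j => x (j - 1)) (Finset.Icc 1 n)
  have hmem : ∀ i j, j ∈ π.part i ↔ i ∈ Finset.Icc 1 n ∧ j ∈ Finset.Icc 1 n ∧
      x (i - 1) = x (j - 1) := fun i j => Finpartition.mem_part_ofSetSetoid_iff_rel _
  refine ⟨π, (blockIndex_restrictedGrowth π).eq_of_pattern h fun i hi j hj => ?_⟩
  have hi' : i + 1 ∈ Finset.Icc 1 n := Finset.mem_Icc.2 (by omega)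
  have hj' : j + 1 ∈ Finset.Icc 1 n := Finset.mem_Icc.2 (by omega)
  rw [blockIndex_eq_iff π hi' hj', eq_comm, ← π.mem_part_iff_part_eq_part hj' hi', hmem,
    Nat.add_sub_cancel, Nat.add_sub_cancel]
  exact ⟨fun h => h.2.2, fun h => ⟨hi', hj', h⟩⟩

theorem canonicalWord_eq (π : Finpartition (Finset.Icc 1 n)) :
    canonicalWord π = (List.range n).map fun i => blockIndex π (i + 1) := by
  rw [canonicalWord, List.range'_eq_map_range, List.map_map]
  exact List.map_congr_left fun i _ => by simp [Nat.add_comm]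

theorem sublist_range_of_pairwise {l : List ℕ} (h : l.Pairwise (· < ·)) (hn : ∀ a ∈ l, a < n) :
    l.Sublist (List.range n) := by
  refine List.sublist_of_subperm_of_sortedLE ?_ (h.imp le_of_lt).sortedLE ?_
  · exact h.sortedLT.nodup.subperm fun a ha => List.mem_range.2 (hn a ha)
  · exact (List.pairwise_lt_range.imp le_of_lt).sortedLE

/-- In a restricted growth word first occurrences come in increasing order, so any 312 pattern is
preceded by the letters that complete it to 12312. -/
theorem avoids_iff (π : Finpartition (Finset.Icc 1 n)) :
    Avoids [1, 2, 3, 1, 2] π ↔ ∀ j k, j < k → k < n →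
      ¬ (blockIndex π (j + 1) < blockIndex π (k + 1) ∧
        blockIndex π (k + 1) < blocksUpTo π j) := by
  have hr := blockIndex_restrictedGrowth π
  have hc := canonicalWord_eq π
  set x : ℕ → ℕ := fun i => blockIndex π (i + 1) with hx
  set m := blocksUpTo π
  change _ ↔ ∀ j k, j < k → k < n → ¬ (x j < x k ∧ x k < m j)
  unfold Avoids
  rw [hc]
  constructor
  · rintro h j k hjk hk ⟨h1, h2⟩
    have hpos := hr.pos j (by omega)
    -- First occurrences, found from right to left: before the first `m j` the maximum is `m j - 1 ≥
    -- x k`, so `x k` has already appeared, and likewise `x j` before it.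
    obtain ⟨j₃, hj₃, hx₃, hm₃⟩ := hr.exists_first (i := j) (a := m j) (by omega) (by omega) le_rfl
    obtain ⟨j₂, hj₂, hx₂, hm₂⟩ := hr.exists_first (i := j₃) (a := x k) (by omega) (by omega)
      (by omega)
    obtain ⟨j₁, hj₁, hx₁, hm₁⟩ := hr.exists_first (i := j₂) (a := x j) (by omega) (by omega)
      (by omega)
    refine h ⟨[j₁, j₂, j₃, j, k].map x, (sublist_range_of_pairwise ?_ ?_).map x, rfl, ?_⟩
    · simp
      omega
    · simp
      omega
    · intro a ha b hb
      simp only [List.map_cons, List.map_nil, List.length_cons, List.length_nil] at ha hb ⊢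
      interval_cases a <;> interval_cases b <;> simp <;> omega
  · rintro h ⟨u, hu, hl, ho⟩
    obtain ⟨v, hv, rfl⟩ := List.sublist_map_iff.1 hu
    rw [List.length_map] at hl ho
    have hpw := List.pairwise_lt_range.sublist hv
    have hlt : ∀ a ∈ v, a < n := fun a ha => List.mem_range.1 (hv.subset ha)
    match v, hl with
    | [a, b, c, d, e], _ =>
      -- Only the last three letters 312 of the pattern are needed.
      have h34 := ho 3 (by simp) 4 (by simp)
      have h42 := ho 4 (by simp) 2 (by simp)
      simp at h34 h42 hpw hlt
      refine h d e (by omega) (by omega) ⟨h34, h42.trans_le (hr.lt_max (by omega) (by omega))⟩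

end BlockIndex

/-! ### Noncrossing partitions and histories. -/

variable {n : ℕ}

theorem mem_active_iff {π : Finpartition (Finset.Icc 1 n)} {i e : ℕ} :
    e ∈ (markedRestriction π i).active ↔ e ≤ i ∧ ∃ j, i ≤ j ∧ j < n ∧ joined π j = some e := by
  simp only [markedRestriction, Finset.mem_filter, ConnectedBeyond, joined_eq_some]
  constructor
  · rintro ⟨⟨h1, h2⟩, k, h3, h4, h5⟩
    rw [Finset.mem_Icc] at h3
    obtain ⟨k, rfl⟩ := Nat.exists_eq_add_of_le' h3.1
    exact ⟨h2, k, by omega, by omega, h5⟩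
  · rintro ⟨h1, j, h2, h3, h4⟩
    exact ⟨⟨h4.mem.1, h1⟩, j + 1, h4.mem.2, by omega, h4⟩

theorem mem_sort_active {π : Finpartition (Finset.Icc 1 n)} {i e : ℕ} :
    e ∈ (markedRestriction π i).active.sort (· ≥ ·) ↔
      e ≤ i ∧ ∃ j, i ≤ j ∧ j < n ∧ joined π j = some e := by
  rw [Finset.mem_sort, mem_active_iff]

theorem isEdge_restrict {s t : Finset ℕ} {π : Finpartition s} (hts : t ≤ s) {i j : ℕ} (hj : j ∈ t)
    (ht : ∀ k ∈ s, k ≤ j → k ∈ t) : IsEdge (π.restrict hts) i j ↔ IsEdge π i j := by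
  constructor
  · rintro ⟨h1, C, hC, hi, hjC, hn⟩
    simp only [Finpartition.restrict, Finset.mem_erase, Finset.mem_image] at hC
    obtain ⟨-, B, hB, rfl⟩ := hC
    rw [Finset.inf_eq_inter, Finset.mem_inter] at hi hjC
    refine ⟨h1, B, hB, hi.1, hjC.1, fun k hk hk' => hn k ?_ hk'⟩
    exact Finset.mem_inter.2 ⟨hk, ht k (π.subset hB hk) hk'.2.le⟩
  · rintro ⟨h1, B, hB, hi, hjB, hn⟩
    refine ⟨h1, B ⊓ t, ?_, ?_, ?_, ?_⟩
    · simp only [Finpartition.restrict, Finset.mem_erase, Finset.mem_image]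
      refine ⟨?_, B, hB, rfl⟩
      exact Finset.ne_empty_of_mem (Finset.mem_inter.2 ⟨hjB, hj⟩)
    · exact Finset.mem_inter.2 ⟨hi, ht i (π.subset hB hi) h1.le⟩
    · exact Finset.mem_inter.2 ⟨hjB, hj⟩
    · exact fun k hk => hn k (Finset.mem_inter.1 hk).1

theorem isEdge_markedRestriction {π : Finpartition (Finset.Icc 1 n)} {i j : ℕ} (hi : i < n) :
    IsEdge (markedRestriction π (i + 1)).partition j (i + 1) ↔ joined π i = some j := by
  rw [joined_eq_some]
  refine isEdge_restrict (Finset.filter_subset _ _) ?_ ?_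
  · rw [Finset.mem_filter, Finset.mem_Icc]
    omega
  · intro k hk hk'
    exact Finset.mem_filter.2 ⟨hk, hk'⟩

/-- A 2-distant noncrossing partition undergoes all the steps of the procedure. -/
theorem IsDistantNoncrossing.exists_history {π : Finpartition (Finset.Icc 1 n)}
    (h : IsDistantNoncrossing 2 π) : ∃ x A m, History n (joined π) x
      (fun i => (markedRestriction π i).active.sort (· ≥ ·)) A m := by
  classical
  obtain ⟨E, h_def⟩ : ∃ E : ℕ → List ℕ,
    E = fun i => (markedRestriction π i).active.sort (· ≥ ·) := ⟨_, rfl⟩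
  rw [← h_def]
  have hmem : ∀ i e, e ∈ E i ↔ e ≤ i ∧ ∃ j, i ≤ j ∧ j < n ∧ joined π j = some e := by
    intro i e
    rw [h_def]
    exact mem_sort_active
  have hsort : ∀ i, (E i).SortedGT := by
    intro i
    rw [h_def]
    exact Finset.sortedGT_sort _
  refine exists_history_of_integers ?_ ?_ ?_
  · refine List.eq_nil_iff_forall_not_mem.2 fun e he => ?_
    obtain ⟨h1, j, -, -, h2⟩ := (hmem _ _).1 he
    have := Finset.mem_Icc.1 (joined_eq_some.1 h2).mem.1
    omega
  · refine List.eq_nil_iff_forall_not_mem.2 fun e he => ?_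
    obtain ⟨h1, j, h2, h3, -⟩ := (hmem _ _).1 he
    omega
  intro i hi
  have hocc : ∀ e, (∃ j, i ≤ j ∧ j < n ∧ joined π j = some e) ↔
      joined π i = some e ∨ ∃ j, i + 1 ≤ j ∧ j < n ∧ joined π j = some e := by
    intro e
    constructor
    · rintro ⟨j, h1, h2, h3⟩
      rcases h1.eq_or_lt with rfl | h1
      · exact Or.inl h3
      · exact Or.inr ⟨j, h1, h2, h3⟩
    · rintro (h1 | ⟨j, h1, h2, h3⟩)
      · exact ⟨i, le_rfl, hi, h1⟩
      · exact ⟨j, by omega, h2, h3⟩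
  have hE : ∀ e, e ∈ E i ↔ e ≤ i ∧
      (joined π i = some e ∨ ∃ j, i + 1 ≤ j ∧ j < n ∧ joined π j = some e) := by
    intro e
    rw [← hocc]
    exact hmem i e
  have hE' : ∀ e, e ∈ E (i + 1) ↔ e ≤ i + 1 ∧ ∃ j, i + 1 ≤ j ∧ j < n ∧ joined π j = some e :=
    fun e => hmem _ e
  have s : (E i).SortedGT := hsort i
  have s' : (E (i + 1)).SortedGT := hsort (i + 1)
  have hle : ∀ e, joined π i = some e → e ≤ i := fun e he => by
    have := (joined_eq_some.1 he).1
    omega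
  have hnot : ∀ e, joined π i = some e → ¬ ∃ j, i + 1 ≤ j ∧ j < n ∧ joined π j = some e := by
    rintro e he ⟨j, h1, h2, h3⟩
    have := (joined_eq_some.1 he).eq_of_left (joined_eq_some.1 h3)
    omega
  -- The edge from `e` to `i + 1` crosses the later edge from `f`; distance less than 2 leaves only
  -- `f = i`.
  have hcross : ∀ e f, joined π i = some e → f ∈ E i → e < f → f = i := by
    intro e f he hf hef
    obtain ⟨h1, h2 | ⟨k, h2, h3, h4⟩⟩ := (hE f).1 hf
    · rw [he, Option.some_inj] at h2
      omega
    · by_contra hfi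
      exact h ⟨e, i + 1, f, k + 1, joined_eq_some.1 he, joined_eq_some.1 h4, hef, by omega,
        by omega, by omega⟩
  -- The integers at most `i` still active once `i + 1` has been joined: the list between closing
  -- and opening.
  let D := (Finset.range (i + 1)).filter fun e => ∃ j, i + 1 ≤ j ∧ j < n ∧ joined π j = some e
  have hD : ∀ e, e ∈ D.sort (· ≥ ·) ↔ e ≤ i ∧ ∃ j, i + 1 ≤ j ∧ j < n ∧ joined π j = some e := by
    intro e
    rw [Finset.mem_sort, Finset.mem_filter, Finset.mem_range, Nat.lt_succ_iff]
  have sD : (D.sort (· ≥ ·)).SortedGT := Finset.sortedGT_sort D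
  generalize D.sort (· ≥ ·) = E₁ at hD sD
  refine ⟨E₁, ?_, ?_⟩
  · rcases hj : joined π i with _ | e
    · refine Or.inl ⟨rfl, s.eq_of_mem_iff sD fun e => ?_⟩
      rw [hE, hD, hj]
      simp
    · right
      have he : e ∈ E i := (hE e).2 ⟨hle e hj, Or.inl hj⟩
      have hsub : ∀ f, f ∈ E₁ ↔ f ∈ E i ∧ f ≠ e := by
        intro f
        rw [hE, hD]
        constructor
        · rintro ⟨h1, h2⟩
          exact ⟨⟨h1, Or.inr h2⟩, fun h3 => hnot e hj (h3 ▸ h2)⟩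
        · rintro ⟨⟨h1, h2⟩, h3⟩
          refine ⟨h1, h2.resolve_left fun h4 => h3 ?_⟩
          rw [hj, Option.some_inj] at h4
          exact h4.symm
      have hc := fun f => hcross e f hj
      generalize E i = L at s he hsub hc
      obtain _ | ⟨f, L⟩ := L
      · simp at he
      · have hp := s.pairwise
        rw [List.pairwise_cons] at hp
        by_cases hf : f = e
        · subst hf
          refine Or.inl ⟨f, rfl, ?_⟩
          congr 1
          refine hp.2.sortedGT.eq_of_mem_iff sD fun a => ?_
          have := hp.1 a
          rw [hsub, List.mem_cons]
          grind
        · have heL : e ∈ L := by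
            rw [List.mem_cons] at he
            exact he.resolve_left (Ne.symm hf)
          obtain rfl := hc f (by simp) (hp.1 e heL)
          obtain _ | ⟨g, L⟩ := L
          · simp at heL
          · have hp' := hp.2
            rw [List.pairwise_cons] at hp'
            have hfg := hp.1 g (by simp)
            have hge : g = e := by
              by_contra hge
              have h1 : e ∈ L := by
                rw [List.mem_cons] at heL
                exact heL.resolve_left (Ne.symm hge)
              have := hc g (by simp) (hp'.1 e h1)
              omega
            subst hge
            refine Or.inr ⟨g, L, rfl, rfl, ?_⟩
            refine sD.eq_of_mem_iff (List.pairwise_cons.2 ⟨fun a ha => ?_, hp'.2⟩).sortedGT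
              fun a => ?_
            · have := hp'.1 a ha
              omega
            · have := hp'.1 a
              rw [hsub, List.mem_cons, List.mem_cons, List.mem_cons]
              grind
  · by_cases ho : ∃ j, i + 1 ≤ j ∧ j < n ∧ joined π j = some (i + 1)
    · right
      refine s'.eq_of_mem_iff (List.pairwise_cons.2 ⟨fun a ha => ?_, sD.pairwise⟩).sortedGT
        fun a => ?_
      · have := ((hD a).1 ha).1
        omega
      · rw [hE', List.mem_cons, hD]
        constructor
        · rintro ⟨h1, h2⟩
          rcases Nat.le_succ_iff.1 h1 with h3 | h3
          · exact Or.inr ⟨h3, h2⟩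
          · exact Or.inl h3
        · rintro (rfl | ⟨h1, h2⟩)
          · exact ⟨le_rfl, ho⟩
          · exact ⟨by omega, h2⟩
    · left
      refine s'.eq_of_mem_iff sD fun a => ?_
      rw [hE', hD]
      constructor
      · rintro ⟨h1, h2⟩
        rcases Nat.le_succ_iff.1 h1 with h3 | rfl
        · exact ⟨h3, h2⟩
        · exact absurd h2 ho
      · rintro ⟨h1, h2⟩
        exact ⟨by omega, h2⟩

section

variable {π : Finpartition (Finset.Icc 1 n)} {x : ℕ → ℕ} {E A : ℕ → List ℕ} {m : ℕ → ℕ}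

/-- A forbidden crossing would have `i₂` active, with `i₁ < i₂ < j₁ - 1`, when `j₁` is joined to
`i₁`; but a move skips no active integer other than `j₁ - 1`. -/
theorem History.isDistantNoncrossing (h : History n (joined π) x E A m) :
    IsDistantNoncrossing 2 π := by
  rintro ⟨i₁, j₁, i₂, j₂, h1, h2, h3, h4, h5, h6⟩
  have hj₁ := Finset.mem_Icc.1 h1.mem.2
  have hj₂ := Finset.mem_Icc.1 h2.mem.2
  obtain ⟨i, rfl⟩ := Nat.exists_eq_add_of_le' hj₁.1
  obtain ⟨k, rfl⟩ := Nat.exists_eq_add_of_le' hj₂.1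
  have hp := joined_eq_some.2 h1
  have hE : i₂ ∈ E i := (h.mem_E (by omega) i₂).2
    ⟨by omega, k, by omega, by omega, joined_eq_some.2 h2⟩
  obtain ⟨E₁, A₁, hm, -⟩ := h.step i (by omega)
  have hI := (h.inv i (by omega)).pairwiseE
  rw [hp] at hm
  generalize A i = b at *
  generalize E i = f at *
  generalize m i = mi at *
  generalize x i = xi at *
  generalize m (i + 1) = mi' at *
  cases hm <;> simp only [List.pairwise_cons, List.mem_cons] at * <;> grind

theorem History.sort_active (h : History n (joined π) x E A m) {i : ℕ} (hi : i ≤ n) :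
    (markedRestriction π i).active.sort (· ≥ ·) = E i := by
  refine (Finset.sortedGT_sort _).eq_of_mem_iff (h.inv i hi).pairwiseE.sortedGT fun e => ?_
  rw [mem_sort_active, h.mem_E hi]

end

/-! ### The marked words of the procedure. -/

theorem maxLetter_append (w : List ℕ) (a : ℕ) :
    maxLetter (w ++ [a]) = max (maxLetter w) a := by
  induction w with
  | nil => simp [maxLetter]
  | cons b w ih =>
    simp only [maxLetter, List.cons_append, List.foldr_cons] at *
    omega

theorem RestrictedGrowth.maxLetter_eq {x m : ℕ → ℕ} (h : RestrictedGrowth n x m) :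
    ∀ i ≤ n, maxLetter ((List.range i).map x) = m i := by
  intro i
  induction i with
  | zero => intro _; rw [h.zero]; rfl
  | succ i ih =>
    intro hi
    rw [List.range_succ, List.map_append, List.map_singleton, maxLetter_append, ih (by omega),
      h.succ i (by omega)]

theorem RestrictedGrowth.idxOf {x m : ℕ → ℕ} (h : RestrictedGrowth n x m) {i a : ℕ} (hi : i ≤ n)
    (ha : 1 ≤ a) (hai : a ≤ m i) :
    ∃ j < i, ((List.range i).map x).idxOf a = j ∧ x j = a ∧ m j + 1 = a := by
  obtain ⟨j, hj, hx, hm⟩ := h.exists_first hi ha hai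
  refine ⟨j, hj, ?_, hx, hm⟩
  have hmem : a ∈ (List.range i).map x := List.mem_map.2 ⟨j, List.mem_range.2 hj, hx⟩
  have hlt := List.idxOf_lt_length_of_mem hmem
  have hget := List.getElem_idxOf hlt
  rw [List.getElem_map, List.getElem_range] at hget
  rw [List.length_map, List.length_range] at hlt
  refine le_antisymm ?_ ?_
  · by_contra hcon
    push Not at hcon
    have h1 := List.not_of_lt_findIdx (p := (· == a)) (xs := (List.range i).map x) (i := j) hcon
    simp [hx] at h1
  · by_contra hcon
    push Not at hcon
    have := h.lt_max hcon (by omega)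
    omega

/-- The positions of the leftmost occurrences in `w` of the letters in `A`. -/
def positions (w A : List ℕ) : Finset ℕ := (A.map fun a => w.idxOf a).toFinset

/-- Larger letters first occur further right, so "rightmost active letter" and "largest active
letter" mean the same. -/
theorem RestrictedGrowth.sort_positions {x m : ℕ → ℕ} (h : RestrictedGrowth n x m) {i : ℕ}
    (hi : i ≤ n) {A : List ℕ} (hA : A.Pairwise (· > ·)) (hb : ∀ a ∈ A, 1 ≤ a ∧ a ≤ m i) :
    (positions ((List.range i).map x) A).sort (· ≥ ·) =
      A.map fun a => ((List.range i).map x).idxOf a := by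
  have hp : (A.map fun a => ((List.range i).map x).idxOf a).Pairwise (· > ·) := by
    rw [List.pairwise_map]
    refine hA.imp_of_mem fun {a b} ha hb' hab => ?_
    obtain ⟨j, hj, hja, hxj, hmj⟩ := h.idxOf hi (hb a ha).1 (hb a ha).2
    obtain ⟨k, hk, hkb, hxk, hmk⟩ := h.idxOf hi (hb b hb').1 (hb b hb').2
    rw [hja, hkb]
    by_contra hcon
    have := h.mono (i := j) (j := k) (by omega) (by omega)
    omega
  exact (List.toFinset_sort _ hp.sortedGT.nodup).2 (hp.imp fun h => h.le)

theorem positions_append {w A : List ℕ} (h : ∀ a ∈ A, a ∈ w) (b : ℕ) :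
    positions (w ++ [b]) A = positions w A := by
  unfold positions
  congr 1
  exact List.map_congr_left fun a ha => List.idxOf_append_of_mem (h a ha)

section

variable {π : Finpartition (Finset.Icc 1 n)} {x : ℕ → ℕ} {E A : ℕ → List ℕ} {m : ℕ → ℕ}

/-- The marked words follow the history. -/
theorem History.markedWord_eq (h : History n (joined π) x E A m) :
    ∀ i ≤ n, markedWord π i =
      some ⟨(List.range i).map x, positions ((List.range i).map x) (A i)⟩ := by
  intro i
  induction i with
  | zero =>
    intro _
    simp [markedWord, h.zeroA, positions]
  | succ i ih =>
    intro hi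
    have hr := h.restrictedGrowth
    have hI := h.inv i (by omega)
    have hS := h.sort_active (i := i) (by omega)
    have hT := h.sort_active hi
    have hQ := hr.sort_positions (i := i) (by omega) hI.pairwiseA hI.boundA
    have hmax := hr.maxLetter_eq i (by omega)
    have hmax' := hr.maxLetter_eq (i + 1) hi
    have hw' : (List.range (i + 1)).map x = (List.range i).map x ++ [x i] := by
      rw [List.range_succ, List.map_append, List.map_singleton]
    have hedge : ∀ j, IsEdge (markedRestriction π (i + 1)).partition j (i + 1) ↔
      joined π i = some j := fun j => isEdge_markedRestriction (by omega)
    have hmemw : ∀ a ∈ A i, a ∈ (List.range i).map x := by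
      intro a ha
      obtain ⟨j, hj, hx, -⟩ := hr.exists_first (i := i) (by omega) (hI.boundA a ha).1
        (hI.boundA a ha).2
      exact List.mem_map.2 ⟨j, List.mem_range.2 hj, hx⟩
    have hget : ∀ a ∈ A i, ((List.range i).map x)[((List.range i).map x).idxOf a]? = some a := by
      intro a ha
      rw [List.getElem?_eq_getElem (List.idxOf_lt_length_of_mem (hmemw a ha)), List.getElem_idxOf]
    rw [markedWord, ih (by omega), hw']
    rw [hw'] at hmax'
    set w := (List.range i).map x
    obtain ⟨E₁, A₁, hm, ho⟩ := h.step i (by omega)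
    have hstep : appendLetter (i + 1) (markedRestriction π i) (markedRestriction π (i + 1))
        ⟨w, positions w (A i)⟩ = some ⟨w ++ [x i], positions (w ++ [x i]) A₁⟩ := by
      have hnd := Finset.sort_nodup (positions w (A i)) (· ≥ ·)
      have hb : ∀ e, joined π i = some e →
          e ∈ (Finset.Icc 1 n).filter (· ≤ i + 1) ∧ e ∈ (markedRestriction π i).active := by
        intro e he
        have h1 := joined_eq_some.1 he
        have h2 := h1.1
        exact ⟨Finset.mem_filter.2 ⟨h1.mem.1, by omega⟩,
          mem_active_iff.2 ⟨by omega, i, le_rfl, by omega, he⟩⟩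
      have hpw := hI.pairwiseE
      simp only [appendLetter, hedge, largest, secondLargest, hS, hQ, hmax]
      rw [hQ] at hnd
      clear ho ih hQ
      generalize hA : A i = B at *
      generalize E i = F at *
      generalize m i = mi at *
      generalize x i = xi at *
      generalize joined π i = pi at *
      generalize m (i + 1) = mi' at *
      have herase : ∀ (b : ℕ) (C : List ℕ), B = b :: C →
          (positions w B).erase (w.idxOf b) = positions w C := by
        rintro b C rfl
        rw [List.map_cons, List.nodup_cons] at hnd
        rw [positions, List.map_cons, List.toFinset_cons, Finset.erase_insert]
        · rfl
        · rw [List.mem_toFinset]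
          exact hnd.1
      cases hm with
      | new =>
        rw [if_pos (by simp), positions_append hmemw]
      | top e _ a _ _ =>
        obtain ⟨h1, h2⟩ := hb e rfl
        rw [if_neg (by push Not; exact ⟨e, h1, rfl⟩), if_pos ⟨e, h2, rfl, rfl⟩]
        rw [positions_append (fun c hc => hmemw c (by simp [hc])), ← herase _ _ rfl]
        simp [hget xi (by simp)]
      | second e _ a _ _ =>
        obtain ⟨h1, h2⟩ := hb e rfl
        have hne : e < i := by
          rw [List.pairwise_cons] at hpw
          exact hpw.1 e (by simp)
        rw [if_neg (by push Not; exact ⟨e, h1, rfl⟩), if_neg, if_pos ⟨e, h2, rfl, rfl⟩]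
        · rw [positions_append (fun c hc => hmemw c (by simp [hc])), ← herase _ _ rfl]
          simp [hget xi (by simp)]
        -- The branch for the largest active integer is not taken: that integer is `i`, whereas the
        -- edge comes from `e < i`.
        · rintro ⟨j, -, h3, h4⟩
          simp at h3 h4
          omega
    have hE₁ : i + 1 ∉ E₁ := by
      intro hmem
      have h1 := hI.boundE
      generalize A i = B at *
      generalize E i = F at *
      generalize m i = mi at *
      generalize x i = xi at *
      generalize joined π i = pi at *
      generalize m (i + 1) = mi' at *
      cases hm with
      | new => have := h1 _ hmem; omega
      | top => have := h1 (i + 1) (by simp [hmem]); omega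
      | second =>
        rw [List.mem_cons] at hmem
        have := h1 (i + 1) (by simp [hmem.resolve_left (by omega)])
        omega
    have hact : i + 1 ∈ (markedRestriction π (i + 1)).active ↔ i + 1 ∈ E (i + 1) := by
      rw [← hT, Finset.mem_sort]
    simp only [Option.bind_eq_bind, Option.bind_some, hstep, activateMax, hact, hmax']
    rcases ho with ⟨h1, h2⟩ | ⟨h1, h2⟩
    · rw [h1, h2, if_neg hE₁]
      rfl
    · rw [h1, h2, if_pos (by simp)]
      simp [positions]

theorem History.finalWord_eq (h : History n (joined π) x E A m) :
    finalWord π = some ((List.range n).map x) := by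
  rw [finalWord, h.markedWord_eq n le_rfl]
  rfl

end

/-! ### Assembling the bijection. -/

theorem avoids_of_restrictedGrowth {σ : Finpartition (Finset.Icc 1 n)} {x m : ℕ → ℕ}
    (h : RestrictedGrowth n x m) (hσ : ∀ i < n, blockIndex σ (i + 1) = x i) :
    Avoids [1, 2, 3, 1, 2] σ ↔ ∀ j k, j < k → k < n → ¬ (x j < x k ∧ x k < m j) := by
  have hm := (blockIndex_restrictedGrowth σ).unique h hσ
  rw [avoids_iff]
  refine forall₂_congr fun j k => forall₂_congr fun hjk hk => ?_
  rw [hσ j (by omega), hσ k hk, hm j (by omega)]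

theorem canonicalWord_eq_map {σ : Finpartition (Finset.Icc 1 n)} {x : ℕ → ℕ}
    (hσ : ∀ i < n, blockIndex σ (i + 1) = x i) : canonicalWord σ = (List.range n).map x := by
  rw [canonicalWord_eq]
  exact List.map_congr_left fun i hi => hσ i (List.mem_range.1 hi)

/-- The procedure can be carried out, and yields the canonical word of a 12312-avoiding
partition. -/
theorem IsDistantNoncrossing.exists_finalWord {π : Finpartition (Finset.Icc 1 n)}
    (h : IsDistantNoncrossing 2 π) : ∃ σ : Finpartition (Finset.Icc 1 n),
      Avoids [1, 2, 3, 1, 2] σ ∧ finalWord π = some (canonicalWord σ) ∧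
      σ.parts.card = π.parts.card := by
  obtain ⟨x, A, m, hist⟩ := h.exists_history
  have hr := hist.restrictedGrowth
  obtain ⟨σ, hσ⟩ := hr.exists_blockIndex_eq
  refine ⟨σ, (avoids_of_restrictedGrowth hr hσ).2 hist.avoiding, ?_, ?_⟩
  · rw [hist.finalWord_eq, canonicalWord_eq_map hσ]
  · rw [← blocksUpTo_self, (blockIndex_restrictedGrowth σ).unique hr hσ n le_rfl,
      hist.card_none n le_rfl, card_parts_eq]

theorem IsDistantNoncrossing.eq_of_finalWord_eq {π ρ : Finpartition (Finset.Icc 1 n)}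
    (h : IsDistantNoncrossing 2 π) (h' : IsDistantNoncrossing 2 ρ)
    (hw : finalWord π = finalWord ρ) : π = ρ := by
  obtain ⟨x, A, m, hist⟩ := h.exists_history
  obtain ⟨y, B, k, hist'⟩ := h'.exists_history
  rw [hist.finalWord_eq, hist'.finalWord_eq, Option.some_inj] at hw
  refine eq_of_joined_eq (hist.unique hist' fun i hi => ?_)
  exact List.map_inj_left.1 hw i (List.mem_range.2 hi)

/-- The joins of the history form a partial injection, since by `mem_E` an integer that has left `E`
is never joined again; hence they are the edges of a partition. -/
theorem exists_finalWord_eq {σ : Finpartition (Finset.Icc 1 n)} (h : Avoids [1, 2, 3, 1, 2] σ) :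
    ∃ π : Finpartition (Finset.Icc 1 n), IsDistantNoncrossing 2 π ∧
      finalWord π = some (canonicalWord σ) := by
  obtain ⟨p, E, A, hist⟩ := (blockIndex_restrictedGrowth σ).exists_history ((avoids_iff σ).1 h)
  have hmem := fun i (hi : i < n) e (he : p i = some e) =>
    (hist.inv i hi.le).mem_of_step (hist.step i hi) he
  obtain ⟨π, hπ⟩ := exists_joined_eq (p := p)
    (fun i hi e he => ⟨(hmem i hi e he).1, (hmem i hi e he).2.1⟩) (by
      intro i j e hij hj hi hje
      refine (hmem i (by omega) e hi).2.2.2 ((hist.mem_E (by omega) e).2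
        ⟨?_, j, hij, hj, hje⟩)
      have := (hmem i (by omega) e hi).2.1
      omega)
  have hist' : History n (joined π) (fun i => blockIndex σ (i + 1)) E A (blocksUpTo σ) :=
    { hist with step := fun i hi => by rw [hπ i hi]; exact hist.step i hi }
  exact ⟨π, hist'.isDistantNoncrossing, by rw [hist'.finalWord_eq, canonicalWord_eq]⟩

end DirectBijection

open DirectBijection in
theorem mainTheorem1 (n : ℕ) :
    ∃ f : {π : Finpartition (Finset.Icc 1 n) // IsDistantNoncrossing 2 π} →
        {σ : Finpartition (Finset.Icc 1 n) // Avoids [1, 2, 3, 1, 2] σ},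
      Function.Bijective f ∧
      (∀ π, finalWord π.1 = some (canonicalWord (f π).1)) ∧
      (∀ π, (f π).1.parts.card = π.1.parts.card) := by
  choose f hf hword hcard using
    fun π : {π : Finpartition (Finset.Icc 1 n) // IsDistantNoncrossing 2 π} => π.2.exists_finalWord
  refine ⟨fun π => ⟨f π, hf π⟩, ⟨fun π ρ h => ?_, fun σ => ?_⟩, hword, hcard⟩
  · have h1 : f π = f ρ := congrArg Subtype.val h
    exact Subtype.ext (π.2.eq_of_finalWord_eq ρ.2 (by rw [hword, hword, h1]))
  · obtain ⟨π, hπ, hw⟩ := exists_finalWord_eq σ.2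
    refine ⟨⟨π, hπ⟩, Subtype.ext (canonicalWord_injective n (Option.some_injective _ ?_))⟩
    rw [← hword, hw]
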